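/- **Setting.** Let $(X,\rho)$ be a finite metric space with $n$ points, with a fixed arbitrary linear order that is used to break ties, and let $k\ge 2$ be an integer. For $S\subseteq X$ and nonempty $T\subseteq X$ let $\rho(x,T)=\min_{y\in T}\rho(x,y)$ and $R(S,T)=\sum_{x\in S}\rho(x,T)$. For an integer $r \ge 0$, let $\mathrm{far}_r(S,T)$ be the set of the $r$ points of $S$ furthest from $T$ (all of $S$ if $|S|<r$), and $R_r(S,T)=R(S\setminus \mathrm{far}_r(S,T),T)$. Let $\mathrm{OPT}\in\mathrm{argmin}\{R(X,T): T\subseteq X,\ 1\le |T|\le k\}$ have centers $c_i^*$, and let the optimal cluster $C_i^*$ consist of the points of $X$ whose closest center in $\mathrm{OPT}$ is $c_i^*$. For $\delta\in(0,1)$ and $\alpha>0$ let $k_+=k+38\log(32k/\delta)$ and $\phi_\alpha=150\log(32k/\delta)/\alpha$, with $\log$ the natural logarithm. An optimal cluster is $\alpha$-large if it has at least $\phi_\alpha$ points; $L_\alpha$ is the union of the $\alpha$-large optimal clusters. An offline $k$-median algorithm $\mathcal A$ maps a finite set $S\subseteq X$ and an integer $m\ge 2$ to a set $\mathcal A(S,m)\subseteq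 S$ of at most $m$ points, nonempty if $S$ is; it is a $\beta$-approximation ($\beta\ge1$) if $R(S,\mathcal A(S,m))\le\beta R(S,T)$ for all such $m$, all $S$ and all nonempty $T\subseteq S$ with $|T|\le m$. **Procedure SelectProc** with parameters $\delta,k,n,\alpha\in(0,1/6],\gamma\in(\alpha,1-2\alpha], M\in\mathbb N,\tau>0$. Phase 1: read the first $\lceil\alpha n\rceil$ points of the stream, call this set $P_1$, and let $T_\alpha=\mathcal A(P_1,\lfloor k_+\rfloor)$. Phase 2: read the next $\lceil\alpha n\rceil$ points, $P_2$, and let $\psi=\frac1{3\alpha}R_{r}(P_2,T_\alpha)$ with $r=\lceil 2\alpha(k+1)\phi_\alpha\rceil$. Phase 3: read the next $\lceil\gamma n\rceil$ points, $P_3$, one by one (in each phase, as many points as are left if the stream ends earlier); a point $x\in P_3$ whose closest center in $T_\alpha$ is $c$ is selected, and then becomes associated with $c$, if and only if $\rho(x,c)>\psi/(k\tau)$, or fewer than $M$ points have been associated with $c$ so far, or no point at distance at most $\psi/(k\tau)$ from $c$ has been associated with $c$ so far. The output $T_{\mathrm{out}}$ is the set of selected points. **Theorem.** There is a universal constant $C>0$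 such that the following holds for all $(X,\rho)$, $k\ge2$, $\delta\in(0,1)$, $\alpha\in(0,1/6]$, $\gamma\in(\alpha,1-2\alpha]$, $M\in\mathbb N$, $\tau>0$, $\beta\ge1$, every optimal $\mathrm{OPT}$, and every $\beta$-approximation offline $k$-median algorithm $\mathcal A$. If the stream is a uniformly random permutation of $X$, then with probability at least $1-\delta/2$ all of the following hold: 1. $|T_{\mathrm{out}}|\le C\left(\frac{\gamma}{\alpha}k\log(k/\delta)+k\tau+(k+\log(k/\delta))M\right)$; 2. for every optimal center $c_i^*\in P_3$, $T_{\mathrm{out}}\neq\emptyset$ and $R(C_i^*,T_{\mathrm{out}})\le R(C_i^*,\{c_i^*\})+\frac{|C_i^*|}{k\tau}(36\beta+20)R(X,\mathrm{OPT})$; 3. if $\gamma=1-2\alpha$, $\tau=\phi_\alpha$ and $M\ge\log(8k_+/\delta)$, then $R(L_\alpha,T_{\mathrm{out}})\le R(L_\alpha,\mathrm{OPT})+(468\beta+260)R(X,\mathrm{OPT})$ (and $T_{\mathrm{out}}\neq\emptyset$ if $L_\alpha\neq\emptyset$). -/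

import Mathlib

namespace NoSubstClustering

/-- The `k`-median risk `R(S,T) = ∑_{x ∈ S} ρ(x,T)`, where `ρ(x,T) = min_{y ∈ T} ρ(x,y)` for
nonempty `T`. (For empty `T` the value of `Metric.infDist` is a convention; all uses below come with
nonemptiness of `T`.) -/
noncomputable def risk {X : Type*} [MetricSpace X] (S T : Finset X) : ℝ :=
  ∑ x ∈ S, Metric.infDist x (T : Set X)

/-- `T` is an optimal `k`-clustering of `S` with centers from `P`:
`T ∈ argmin {R(S,T') | ∅ ≠ T' ⊆ P, |T'| ≤ k}`. -/
def IsOptimal {X : Type*} [MetricSpace X] (P S : Finset X) (k : ℕ) (T : Finset X) : Prop :=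
  (T ⊆ P ∧ T.Nonempty ∧ T.card ≤ k) ∧
    ∀ T' ⊆ P, T'.Nonempty → T'.card ≤ k → risk S T ≤ risk S T'

/-- `A` is an offline `k`-median algorithm on `X`: for a finite point set `S` and a parameter
`k ≥ 2`, it outputs a `k`-clustering of `S`. -/
def IsOfflineAlgorithm {X : Type*} (A : Finset X → ℕ → Finset X) : Prop :=
  ∀ (S : Finset X) (k : ℕ), 2 ≤ k →
    A S k ⊆ S ∧ (A S k).card ≤ k ∧ (S.Nonempty → (A S k).Nonempty)

/-- The `β`-approximation property: `R(S, A(S,k)) ≤ β R(S, OPT_S)` for all `S` and `k ≥ 2`, where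
`OPT_S` is an optimal `k`-clustering of `S` with centers from `S`. -/
def IsApproximation {X : Type*} [MetricSpace X] (β : ℝ) (A : Finset X → ℕ → Finset X) : Prop :=
  ∀ (S : Finset X) (k : ℕ), 2 ≤ k →
    ∀ OPT_S : Finset X, IsOptimal S S k OPT_S → risk S (A S k) ≤ β * risk S OPT_S

open Classical in
/-- The center in `T` closest to `x`, with ties broken by the fixed ordering of `X`
(the value for empty `T` is a dummy). -/
noncomputable def nearest {X : Type*} [MetricSpace X] [LinearOrder X] (T : Finset X) (x : X) : X :=
  if h : (T.filter fun c => ∀ c' ∈ T, dist x c ≤ dist x c').Nonempty then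
    (T.filter fun c => ∀ c' ∈ T, dist x c ≤ dist x c').min' h
  else x

/-- The cluster of `X` induced by the center `c` of the clustering `T`. -/
noncomputable def cluster {X : Type*} [Fintype X] [MetricSpace X] [LinearOrder X]
    (T : Finset X) (c : X) : Finset X :=
  Finset.univ.filter fun x => nearest T x = c

open Classical in
/-- `far_r(S,T)`: the `r` points of `S` that are furthest from `T` (all of `S` if `|S| < r`), with
ties broken by the fixed ordering of `X`. A point belongs to it iff fewer than `r` points of `S`
precede it when `S` is listed by decreasing distance from `T`. -/
noncomputable def far {X : Type*} [MetricSpace X] [LinearOrder X]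
    (r : ℕ) (S T : Finset X) : Finset X :=
  S.filter fun x =>
    (S.filter fun y =>
      Metric.infDist x (T : Set X) < Metric.infDist y (T : Set X) ∨
        (Metric.infDist x (T : Set X) = Metric.infDist y (T : Set X) ∧ y < x)).card < r

/-- `R_r(S,T)`: the risk of `T` on `S` after discounting the `r` points incurring the most risk. -/
noncomputable def truncRisk {X : Type*} [MetricSpace X] [LinearOrder X]
    (r : ℕ) (S T : Finset X) : ℝ :=
  risk (S \ far r S T) T

/-- `k₊ = k + 38 log(32k/δ)`. -/
noncomputable def kPlus (k : ℕ) (δ : ℝ) : ℝ := k + 38 * Real.log (32 * k / δ)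

/-- `φ_α = 150 log(32k/δ)/α`. -/
noncomputable def phi (k : ℕ) (δ α : ℝ) : ℝ := 150 * Real.log (32 * k / δ) / α

/-- `P₁`: the first `α n` points of the stream. Phase lengths are rounded up. -/
noncomputable def phase1 {X : Type*} (n : ℕ) (α : ℝ) (stream : List X) : List X :=
  stream.take ⌈α * n⌉₊

/-- `P₂`: the next `α n` points of the stream. -/
noncomputable def phase2 {X : Type*} (n : ℕ) (α : ℝ) (stream : List X) : List X :=
  (stream.drop ⌈α * n⌉₊).take ⌈α * n⌉₊

/-- `P₃`: the next `γ n` points of the stream (or as many of them as are left). -/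
noncomputable def phase3 {X : Type*} (n : ℕ) (α γ : ℝ) (stream : List X) : List X :=
  (stream.drop (2 * ⌈α * n⌉₊)).take ⌈γ * n⌉₊

/-- The reference clustering `T_α = A(P₁, k₊)`, a clustering with at most `k₊` centers. -/
noncomputable def refClustering {X : Type*} [LinearOrder X] (A : Finset X → ℕ → Finset X)
    (δ : ℝ) (k n : ℕ) (α : ℝ) (stream : List X) : Finset X :=
  A (phase1 n α stream).toFinset ⌊kPlus k δ⌋₊

/-- The risk estimate `ψ = R_{2α(k+1)φ_α}(P₂, T_α) / (3α)`. -/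
noncomputable def riskEstimate {X : Type*} [MetricSpace X] [LinearOrder X]
    (A : Finset X → ℕ → Finset X) (δ : ℝ) (k n : ℕ) (α : ℝ) (stream : List X) : ℝ :=
  1 / (3 * α) *
    truncRisk ⌈2 * α * (k + 1) * phi k δ α⌉₊ (phase2 n α stream).toFinset
      (refClustering A δ k n α stream)

/-- The state kept during the third phase: the set of points selected so far and, for each center
`c` of the reference clustering, the number of selected points associated with `c` and the Boolean
variable telling whether a point close to `c` has been selected. -/
structure SelectState (X : Type*) where
  selected : Finset X
  count : X → ℕ
  near : X → Bool

open Classical in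
/-- Reading one point `x` in the third phase, with reference clustering `T`, distance threshold
`θ` and parameter `M`. The point is selected iff it is at distance more than `θ` from its closest
center `c`, or `c` does not yet have `M` associated points, or no point close to `c` has been
selected so far. -/
noncomputable def selectStep {X : Type*} [MetricSpace X] [LinearOrder X]
    (T : Finset X) (θ : ℝ) (M : ℕ) (s : SelectState X) (x : X) : SelectState X :=
  let c := nearest T x
  if θ < dist x c ∨ s.count c < M ∨ s.near c = false then
    { selected := insert x s.selected
      count := Function.update s.count c (s.count c + 1)
      near := if dist x c ≤ θ then Function.update s.near c true else s.near }
  else s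

/-- The procedure `SelectProc`: the set `T_out` of centers selected from the stream. -/
noncomputable def selectProc {X : Type*} [MetricSpace X] [LinearOrder X]
    (A : Finset X → ℕ → Finset X) (δ : ℝ) (k n : ℕ) (α γ : ℝ) (M : ℕ) (τ : ℝ)
    (stream : List X) : Finset X :=
  ((phase3 n α γ stream).foldl
    (selectStep (refClustering A δ k n α stream)
      (riskEstimate A δ k n α stream / (k * τ)) M)
    { selected := ∅, count := fun _ => 0, near := fun _ => false }).selected

open Classical in
/-- The points in `α`-large optimal clusters, i.e. optimal clusters with at least `φ_α` points. -/
noncomputable def largePoints {X : Type*} [Fintype X] [MetricSpace X] [LinearOrder X]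
    (k : ℕ) (δ α : ℝ) (OPT : Finset X) : Finset X :=
  (OPT.filter fun c => phi k δ α ≤ ((cluster OPT c).card : ℝ)).biUnion (cluster OPT)

/-- The probability of the event `E` when the stream is a uniformly random permutation of `X`: the
fraction of the orderings of `X` that belong to `E`. -/
noncomputable def streamProb {X : Type*} [Fintype X] (E : Set (Fin (Fintype.card X) ≃ X)) : ℝ :=
  (E.ncard : ℝ) / (Nat.card (Fin (Fintype.card X) ≃ X) : ℝ)

end NoSubstClustering

/-!
The argument compares everything with the optimal clustering `OPT`, of risk `R`. Write
`L = log (32 k / δ)`, so that `exp (-L) = δ / (32 k)` and the budget `δ / 2` pays for `16 k` events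
of probability `exp (-L)`.

**Concentration.** For `z ≥ 0` and a uniformly random bijection `σ`, the expectation of
`∏ i ∈ I, z (σ i)` is at most the `|I|`-th power of the mean of `z` (`sum_prod_le`): enlarging `I` by
one position multiplies the expectation by at most the mean, because exchanging two positions turns
the difference of the two sides into a sum of squares. This gives Chernoff bounds for every window
of the stream (`chernoff`). Statements about later phases that involve the reference clustering are
reduced to this by averaging over the permutations of a set of values that are not read in the first
phase (`ncard_inter_le_of_perm`).

**The risk estimate.** At most `20 L / α` points are heavy, i.e. cost more than `α R / (20 L)`; on
the other points the costs are bounded, so that each of the samples `P₁`, `P₂` has cost at most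
`2 α R` there. The `38 L` additional centers of the reference clustering `T` can serve the heavy
points of `P₁`, so `T` costs at most `4 α β R` on `P₁` (`risk_offline_le`). As `P₁` contains a
proportional share of each large cluster, mostly of points that are not heavy, the centers of the
large clusters are on average close to `T` (`GoodSamples.sum_card_mul_infDist_le`). The truncation
in the estimate `ψ` removes the heavy points and the small clusters from `P₂`, hence
`ψ ≤ (18 β + 10) R` (`GoodSamples.truncRisk_le`). A center of `OPT` that is read in the third phase
is selected or within `2 ψ / (k τ)` of a selected point, which is the second assertion.

**Size.** By Markov's inequality few points of `P₂` are further than `ψ / (k τ)` from `T`. The points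
beyond a threshold form a prefix of the list of all unread points by decreasing distance from `T`,
and one prefix of fixed length `J` serves for all thresholds: it has more than the allowed number of
points in `P₂`, and at most `3 γ J` in `P₃` (`chernoff_far`, `card_far_points_le`).

**Large clusters.** Consider the cells of `T` in the third phase. If at most a quarter of a cell lies
outside the large clusters, then all but `7/20 ≤ 1/e` of its points are within a radius controlled
by the average cost of the large clusters in the cell; one of the first `M` points of the cell, all
of which are selected, is within this radius with probability at least `1 - exp (-M)`
(`ncard_firstOuter_le`). In the other cells, the points of large clusters are at most three times as
many as those of small clusters, of which there are at most `k φ`, and each of them pays at most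
`ψ / (k φ)` more than with `T` (`risk_selected_inter_le`). Finally the third phase contains half of
each large cluster, so its cost bounds that of the whole cluster.
-/

namespace NoSubstClustering

/-! ### Sampling without replacement -/

/-- One step of the comparison with independent sampling: enlarging the set of sampled positions by
one position multiplies the expected product by at most the mean of `z`. -/
theorem card_mul_sum_prod_insert_le {ι κ : Type*} [Fintype ι] [DecidableEq ι] [Fintype κ]
    [DecidableEq κ] {z : κ → ℝ} (hz : ∀ x, 0 ≤ z x) (I : Finset ι) {b : ι} (hb : b ∉ I) :
    (Fintype.card ι : ℝ) * ∑ σ : ι ≃ κ, ∏ i ∈ insert b I, z (σ i) ≤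
      (∑ x, z x) * ∑ σ : ι ≃ κ, ∏ i ∈ I, z (σ i) := by
  have reindex : ∀ (a : ι) (g : (ι ≃ κ) → ℝ),
      ∑ σ : ι ≃ κ, g ((Equiv.swap a b).trans σ) = ∑ σ : ι ≃ κ, g σ := by
    intro a g
    have hinv : Function.Involutive (fun σ : ι ≃ κ => (Equiv.swap a b).trans σ) := by
      intro σ
      ext i
      simp
    exact hinv.bijective.sum_comp g
  have key : ∀ j : ι, ∑ σ : ι ≃ κ, ∏ i ∈ insert b I, z (σ i) ≤
      ∑ σ : ι ≃ κ, (∏ i ∈ I, z (σ i)) * z (σ j) := by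
    intro j
    simp only [Finset.prod_insert hb]
    by_cases hj : j ∈ I
    · -- symmetrizing over the transposition of `j` and `b` leaves a sum of squares
      have hjb : j ≠ b := fun h => hb (h ▸ hj)
      have hsplit : ∀ σ : ι ≃ κ, ∏ i ∈ I, z (σ i) = z (σ j) * ∏ i ∈ I.erase j, z (σ i) :=
        fun σ => (Finset.mul_prod_erase I (fun i => z (σ i)) hj).symm
      have hswap : ∀ σ : ι ≃ κ, ∏ i ∈ I.erase j, z (((Equiv.swap j b).trans σ) i) =
          ∏ i ∈ I.erase j, z (σ i) := by
        intro σ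
        refine Finset.prod_congr rfl fun i hi => ?_
        have h1 : i ≠ j := Finset.ne_of_mem_erase hi
        have h2 : i ≠ b := fun h => hb (h ▸ Finset.mem_of_mem_erase hi)
        simp [Equiv.swap_apply_of_ne_of_ne h1 h2]
      have e := reindex j (fun σ => (∏ i ∈ I, z (σ i)) * z (σ j))
      have h2 : 2 * ∑ σ : ι ≃ κ, z (σ b) * ∏ i ∈ I, z (σ i) ≤
          ∑ σ : ι ≃ κ, (∏ i ∈ I, z (σ i)) * z (σ j) +
          ∑ σ : ι ≃ κ, (∏ i ∈ I, z (((Equiv.swap j b).trans σ) i)) *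
            z (((Equiv.swap j b).trans σ) j) := by
        rw [← Finset.sum_add_distrib, Finset.mul_sum]
        refine Finset.sum_le_sum fun σ _ => ?_
        rw [hsplit ((Equiv.swap j b).trans σ), hswap, hsplit σ]
        have : 0 ≤ ∏ i ∈ I.erase j, z (σ i) := Finset.prod_nonneg fun i _ => hz _
        simp only [Equiv.trans_apply, Equiv.swap_apply_left]
        nlinarith [mul_nonneg this (sq_nonneg (z (σ j) - z (σ b)))]
      linarith
    · rw [← reindex j]
      refine le_of_eq (Finset.sum_congr rfl fun σ _ => ?_)
      rw [mul_comm]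
      congr 1
      · refine Finset.prod_congr rfl fun i hi => ?_
        have h1 : i ≠ j := fun h => hj (h ▸ hi)
        have h2 : i ≠ b := fun h => hb (h ▸ hi)
        simp [Equiv.swap_apply_of_ne_of_ne h1 h2]
      · simp
  calc (Fintype.card ι : ℝ) * ∑ σ : ι ≃ κ, ∏ i ∈ insert b I, z (σ i)
      = ∑ _j : ι, ∑ σ : ι ≃ κ, ∏ i ∈ insert b I, z (σ i) := by simp
    _ ≤ ∑ j : ι, ∑ σ : ι ≃ κ, (∏ i ∈ I, z (σ i)) * z (σ j) :=
        Finset.sum_le_sum fun j _ => key j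
    _ = (∑ x, z x) * ∑ σ : ι ≃ κ, ∏ i ∈ I, z (σ i) := by
        rw [Finset.sum_comm, Finset.mul_sum]
        refine Finset.sum_congr rfl fun σ _ => ?_
        rw [← Finset.mul_sum, σ.sum_comp z, mul_comm]

/-- Sampling without replacement is dominated by independent sampling: for `z ≥ 0` and a uniformly
random bijection `σ`, the expectation of `∏ i ∈ I, z (σ i)` is at most the `|I|`-th power of the
mean of `z`. -/
theorem sum_prod_le {ι κ : Type*} [Fintype ι] [DecidableEq ι] [Fintype κ]
    [DecidableEq κ] {z : κ → ℝ} (hz : ∀ x, 0 ≤ z x) (I : Finset ι) :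
    (Fintype.card ι : ℝ) ^ I.card * ∑ σ : ι ≃ κ, ∏ i ∈ I, z (σ i) ≤
      (∑ x, z x) ^ I.card * (Nat.card (ι ≃ κ) : ℝ) := by
  induction I using Finset.induction_on with
  | empty => simp [Nat.card_eq_fintype_card]
  | insert b I hb ih =>
    have h1 := card_mul_sum_prod_insert_le hz I hb
    rw [Finset.card_insert_of_notMem hb, pow_succ, pow_succ]
    have hZ : 0 ≤ ∑ x, z x := Finset.sum_nonneg fun x _ => hz x
    have hn : (0 : ℝ) ≤ (Fintype.card ι : ℝ) ^ I.card := by positivity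
    nlinarith [mul_le_mul_of_nonneg_left h1 hn, mul_le_mul_of_nonneg_left ih hZ]

theorem ncard_eq_sum_ite {Ω : Type*} [Fintype Ω] (E : Set Ω) [DecidablePred (· ∈ E)] :
    (E.ncard : ℝ) = ∑ σ : Ω, if σ ∈ E then 1 else 0 := by
  rw [Set.ncard_eq_toFinset_card']
  simp [Set.toFinset]

theorem ncard_le_sum {Ω : Type*} [Fintype Ω] (E : Set Ω) (g : Ω → ℝ) (hg : ∀ σ, 0 ≤ g σ)
    (hE : ∀ σ ∈ E, 1 ≤ g σ) : (E.ncard : ℝ) ≤ ∑ σ : Ω, g σ := by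
  classical
  rw [ncard_eq_sum_ite]
  refine Finset.sum_le_sum fun σ _ => ?_
  split_ifs with h
  · exact hE σ h
  · exact hg σ

/-- The Chernoff bound for sampling without replacement, for weights in `[0,1]`. Positive `s` gives
the upper tail and negative `s` the lower tail. -/
theorem chernoff {ι κ : Type*} [Fintype ι] [Nonempty ι] [Fintype κ]
    {w : κ → ℝ} (hw0 : ∀ x, 0 ≤ w x) (hw1 : ∀ x, w x ≤ 1) (I : Finset ι) {s t A : ℝ}
    (hA : I.card * (∑ x, w x) * (Real.exp s - 1) ≤ A * Fintype.card ι) :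
    ({σ : ι ≃ κ | s * t ≤ s * ∑ i ∈ I, w (σ i)}.ncard : ℝ) ≤
      Real.exp (A - s * t) * Nat.card (ι ≃ κ) := by
  classical
  rcases isEmpty_or_nonempty (ι ≃ κ) with he | ⟨⟨σ₀⟩⟩
  · have : {σ : ι ≃ κ | s * t ≤ s * ∑ i ∈ I, w (σ i)} = ∅ := Subsingleton.elim _ _
    simp [this]
  have hcard : Fintype.card κ = Fintype.card ι := (Fintype.card_congr σ₀).symm
  set n : ℝ := (Fintype.card ι : ℝ) with hn
  have hn0 : 0 < n := by rw [hn]; exact_mod_cast Fintype.card_pos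
  set W := ∑ x, w x with hW
  have hz : ∀ x, 0 ≤ Real.exp (s * w x) := fun x => (Real.exp_pos _).le
  have h1 := sum_prod_le (ι := ι) hz I
  -- convexity of the exponential
  have hconv : ∀ x, Real.exp (s * w x) ≤ 1 + w x * (Real.exp s - 1) := by
    intro x
    have := convexOn_exp.2 (Set.mem_univ 0) (Set.mem_univ s) (sub_nonneg.2 (hw1 x)) (hw0 x)
      (by ring)
    simp only [smul_eq_mul, mul_zero, zero_add, Real.exp_zero, mul_one] at this
    rw [mul_comm s]
    linarith
  have hZ : ∑ x, Real.exp (s * w x) ≤ n * Real.exp (W * (Real.exp s - 1) / n) := by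
    calc ∑ x, Real.exp (s * w x) ≤ ∑ x, (1 + w x * (Real.exp s - 1)) :=
          Finset.sum_le_sum fun x _ => hconv x
      _ = n * (W * (Real.exp s - 1) / n + 1) := by
          rw [Finset.sum_add_distrib, ← Finset.sum_mul, Finset.sum_const, Finset.card_univ, hcard,
            nsmul_eq_mul]
          field_simp
          ring
      _ ≤ _ := mul_le_mul_of_nonneg_left (Real.add_one_le_exp _) hn0.le
  have hZ0 : 0 ≤ ∑ x, Real.exp (s * w x) := Finset.sum_nonneg fun x _ => hz x
  have h2 : (∑ x, Real.exp (s * w x)) ^ I.card ≤ n ^ I.card * Real.exp A := by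
    refine (pow_le_pow_left₀ hZ0 hZ _).trans ?_
    rw [mul_pow, ← Real.exp_nat_mul]
    refine mul_le_mul_of_nonneg_left (Real.exp_le_exp.2 ?_) (by positivity)
    rw [← mul_div_assoc, div_le_iff₀ hn0]
    linarith
  have hmgf : ∑ σ : ι ≃ κ, ∏ i ∈ I, Real.exp (s * w (σ i)) ≤
      Real.exp A * (Nat.card (ι ≃ κ) : ℝ) := by
    have hp : 0 < n ^ I.card := by positivity
    refine le_of_mul_le_mul_left ?_ hp
    refine h1.trans ((mul_le_mul_of_nonneg_right h2 (by positivity)).trans (le_of_eq (by ring)))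
  calc ({σ : ι ≃ κ | s * t ≤ s * ∑ i ∈ I, w (σ i)}.ncard : ℝ)
      ≤ ∑ σ : ι ≃ κ, Real.exp (-(s * t)) * ∏ i ∈ I, Real.exp (s * w (σ i)) := by
        refine ncard_le_sum _ _ (fun σ => by positivity) fun σ hσ => ?_
        rw [← Real.exp_sum, ← Real.exp_add, ← Finset.mul_sum]
        have : s * t ≤ s * ∑ i ∈ I, w (σ i) := hσ
        exact Real.one_le_exp (by linarith)
    _ ≤ Real.exp (-(s * t)) * (Real.exp A * (Nat.card (ι ≃ κ) : ℝ)) := by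
        rw [← Finset.mul_sum]
        exact mul_le_mul_of_nonneg_left hmgf (by positivity)
    _ = _ := by rw [← mul_assoc, ← Real.exp_add]; ring_nf

/-- The probability that all positions of `I` receive a value in `B` is at most
`(|B| / |ι|) ^ |I|`. -/
theorem ncard_forall_mem_le {ι κ : Type*} [Fintype ι] [Fintype κ] (B : Finset κ)
    (I : Finset ι) {ρ : ℝ} (hρ : (B.card : ℝ) ≤ ρ * Fintype.card ι) :
    ({σ : ι ≃ κ | ∀ i ∈ I, σ i ∈ B}.ncard : ℝ) ≤ ρ ^ I.card * Nat.card (ι ≃ κ) := by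
  classical
  rcases isEmpty_or_nonempty ι with he | hne
  · have hI : I = ∅ := Finset.eq_empty_of_isEmpty I
    subst hI
    simp [Set.ncard_univ]
  have hz : ∀ x : κ, 0 ≤ (if x ∈ B then (1 : ℝ) else 0) := fun x => by split_ifs <;> norm_num
  have h1 := sum_prod_le (ι := ι) hz I
  have hs : ∑ x : κ, (if x ∈ B then (1 : ℝ) else 0) = B.card := by simp
  rw [hs] at h1
  have hn0 : (0 : ℝ) < Fintype.card ι := by exact_mod_cast Fintype.card_pos
  have hp : (0 : ℝ) < (Fintype.card ι : ℝ) ^ I.card := by positivity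
  refine (ncard_le_sum _ (fun σ : ι ≃ κ => ∏ i ∈ I, (if σ i ∈ B then (1 : ℝ) else 0))
    (fun σ => Finset.prod_nonneg fun i _ => hz _) fun σ hσ => ?_).trans ?_
  · refine le_of_eq (Finset.prod_eq_one fun i hi => ?_).symm
    simp [hσ i hi]
  · refine le_of_mul_le_mul_left (h1.trans ?_) hp
    have : (B.card : ℝ) ^ I.card ≤ (ρ * Fintype.card ι) ^ I.card :=
      pow_le_pow_left₀ (by positivity) hρ _
    rw [mul_pow] at this
    refine (mul_le_mul_of_nonneg_right this (by positivity)).trans (le_of_eq (by ring))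

/-! ### Conditional sampling and windows of a random stream -/

/-- Averaging over the permutations of an invariant set of values: if, from every `σ ∈ D`, a
uniformly random permutation of the values in `V σ` leads into `E` with probability at most `ε`,
then `E` has conditional probability at most `ε` given `D`. -/
theorem ncard_inter_le_of_perm {ι X : Type*} [Fintype ι] [Fintype X] [DecidableEq X]
    (V : (ι ≃ X) → Finset X) (D E : Set (ι ≃ X)) {ε : ℝ}
    (hV : ∀ σ, ∀ π : Equiv.Perm (V σ), V (σ.trans (Equiv.Perm.ofSubtype π)) = V σ)
    (hD : ∀ σ ∈ D, ∀ π : Equiv.Perm (V σ), σ.trans (Equiv.Perm.ofSubtype π) ∈ D)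
    (hE : ∀ σ ∈ D, ({π : Equiv.Perm (V σ) | σ.trans (Equiv.Perm.ofSubtype π) ∈ E}.ncard : ℝ) ≤
      ε * Nat.card (Equiv.Perm (V σ))) :
    ((D ∩ E).ncard : ℝ) ≤ ε * D.ncard := by
  classical
  -- the streams with `V σ = V₀` are invariant under the permutations of `V₀`, over which one averages
  have fiber : ∀ V₀ : Finset X,
      (∑ σ : ι ≃ X, if σ ∈ D ∩ E ∧ V σ = V₀ then (1 : ℝ) else 0) ≤
        ε * ∑ σ : ι ≃ X, if σ ∈ D ∧ V σ = V₀ then (1 : ℝ) else 0 := by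
    intro V₀
    set G := Equiv.Perm V₀
    have hG : (0 : ℝ) < Fintype.card G := by exact_mod_cast Fintype.card_pos
    set a : (ι ≃ X) → ℝ := fun σ => if σ ∈ D ∩ E ∧ V σ = V₀ then (1 : ℝ) else 0 with ha
    have shift : ∀ π : G, ∑ σ : ι ≃ X, a (σ.trans (Equiv.Perm.ofSubtype π)) = ∑ σ, a σ := by
      intro π
      have hb : Function.Bijective (fun σ : ι ≃ X => σ.trans (Equiv.Perm.ofSubtype π)) := by
        refine Function.bijective_iff_has_inverse.2
          ⟨fun σ : ι ≃ X => σ.trans (Equiv.Perm.ofSubtype π).symm, fun σ => ?_, fun σ => ?_⟩ <;>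
        · ext i
          simp
      exact hb.sum_comp a
    have inner : ∀ σ : ι ≃ X, ∑ π : G, a (σ.trans (Equiv.Perm.ofSubtype π)) ≤
        ε * Fintype.card G * (if σ ∈ D ∧ V σ = V₀ then (1 : ℝ) else 0) := by
      intro σ
      by_cases hσ : σ ∈ D ∧ V σ = V₀
      · obtain ⟨hσD, rfl⟩ := hσ
        have h := hE σ hσD
        rw [ncard_eq_sum_ite, Nat.card_eq_fintype_card] at h
        simp only [ha, hσD, and_self, if_true, mul_one]
        refine le_trans (le_of_eq (Finset.sum_congr rfl fun π _ => ?_)) h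
        simp [hV σ π, hD σ hσD π]
      · rw [if_neg hσ, mul_zero]
        refine le_of_eq (Finset.sum_eq_zero fun π _ => if_neg ?_)
        rintro ⟨⟨h1, -⟩, h2⟩
        apply hσ
        set σ' := σ.trans (Equiv.Perm.ofSubtype π) with hσ'
        have back : ∀ (V₁ : Finset X) (h : V₁ = V₀), ∃ π' : Equiv.Perm V₁,
            σ'.trans (Equiv.Perm.ofSubtype π') = σ := by
          rintro V₁ rfl
          refine ⟨π⁻¹, ?_⟩
          ext i
          simp [hσ']
        obtain ⟨π', hπ'⟩ := back (V σ') h2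
        have e1 := hD σ' h1 π'
        have e2 := hV σ' π'
        rw [hπ'] at e1 e2
        exact ⟨e1, e2.trans h2⟩
    have hsum : (Fintype.card G : ℝ) * ∑ σ, a σ = ∑ σ : ι ≃ X, ∑ π : G,
        a (σ.trans (Equiv.Perm.ofSubtype π)) := by
      rw [Finset.sum_comm, Finset.sum_congr rfl fun π _ => shift π]
      simp
    refine le_of_mul_le_mul_left ?_ hG
    rw [hsum]
    refine (Finset.sum_le_sum fun σ _ => inner σ).trans (le_of_eq ?_)
    rw [← Finset.mul_sum]
    ring
  have split : ∀ S : Set (ι ≃ X), (S.ncard : ℝ) =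
      ∑ V₀ : Finset X, ∑ σ : ι ≃ X, if σ ∈ S ∧ V σ = V₀ then (1 : ℝ) else 0 := by
    intro S
    rw [ncard_eq_sum_ite, Finset.sum_comm]
    refine Finset.sum_congr rfl fun σ _ => ?_
    by_cases h : σ ∈ S <;> simp [h]
  rw [split, split, Finset.mul_sum]
  refine Finset.sum_le_sum fun V₀ _ => ?_
  refine le_of_eq_of_le (Finset.sum_congr rfl fun σ _ => ?_) (fiber V₀)
  congr

/-- The values of `Q` under a random permutation of `V`, as a sum over the subtype `V`. -/
theorem card_filter_ofSubtype {X : Type*} [DecidableEq X] {V Q : Finset X} (hQ : Q ⊆ V)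
    (B : Finset X) (π : Equiv.Perm V) :
    ((Q.filter fun x => Equiv.Perm.ofSubtype π x ∈ B).card : ℝ) =
      ∑ i ∈ Q.subtype (· ∈ V), (fun x : V => if (x : X) ∈ B then (1 : ℝ) else 0) (π i) := by
  have h : ∑ x ∈ Q, (if Equiv.Perm.ofSubtype π x ∈ B then (1 : ℝ) else 0) =
      ((Q.filter fun x => Equiv.Perm.ofSubtype π x ∈ B).card : ℝ) := by simp
  rw [← h, ← Finset.sum_subtype_of_mem
    (fun x => if Equiv.Perm.ofSubtype π x ∈ B then (1 : ℝ) else 0) hQ]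
  refine Finset.sum_congr rfl fun i _ => ?_
  simp only [Equiv.Perm.ofSubtype_apply_coe]

theorem card_subtype_of_subset {X : Type*} [DecidableEq X] {V Q : Finset X} (hQ : Q ⊆ V) :
    (Q.subtype (· ∈ V)).card = Q.card := by
  rw [Finset.card_subtype, Finset.filter_true_of_mem hQ]

/-- The Chernoff bound for the number of points of `Q` sent into `B` by a random permutation. -/
theorem chernoff_perm {X : Type*} [DecidableEq X] {V Q B : Finset X} (hV : V.Nonempty)
    (hQ : Q ⊆ V) (hB : B ⊆ V) {s t A : ℝ}
    (hA : Q.card * B.card * (Real.exp s - 1) ≤ A * V.card) :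
    ({π : Equiv.Perm V | s * t ≤
        s * ((Q.filter fun x => Equiv.Perm.ofSubtype π x ∈ B).card : ℝ)}.ncard : ℝ) ≤
      Real.exp (A - s * t) * Nat.card (Equiv.Perm V) := by
  have : Nonempty V := hV.to_subtype
  have hw0 : ∀ x : V, 0 ≤ (if (x : X) ∈ B then (1 : ℝ) else 0) := fun x => by
    split_ifs <;> norm_num
  have hw1 : ∀ x : V, (if (x : X) ∈ B then (1 : ℝ) else 0) ≤ 1 := fun x => by
    split_ifs <;> norm_num
  have hsum : ∑ x : V, (if (x : X) ∈ B then (1 : ℝ) else 0) = B.card := by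
    rw [Finset.sum_coe_sort V (fun x => if x ∈ B then (1 : ℝ) else 0)]
    simp [Finset.inter_eq_right.2 hB]
  have h := chernoff (ι := V) (κ := V) hw0 hw1 (Q.subtype (· ∈ V)) (s := s) (t := t) (A := A)
    (by rw [card_subtype_of_subset hQ, hsum, Fintype.card_coe]; exact hA)
  simp only [card_filter_ofSubtype hQ]
  exact h

theorem ncard_perm_forall_mem_le {X : Type*} [DecidableEq X] {V Q B : Finset X}
    (hQ : Q ⊆ V) (hB : B ⊆ V) {ρ : ℝ} (hρ : (B.card : ℝ) ≤ ρ * V.card) :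
    ({π : Equiv.Perm V | ∀ x ∈ Q, Equiv.Perm.ofSubtype π x ∈ B}.ncard : ℝ) ≤
      ρ ^ Q.card * Nat.card (Equiv.Perm V) := by
  have h := ncard_forall_mem_le (ι := V) (B.subtype (· ∈ V)) (Q.subtype (· ∈ V)) (ρ := ρ)
    (by rw [card_subtype_of_subset hB, Fintype.card_coe]; exact hρ)
  rw [card_subtype_of_subset hQ] at h
  convert h using 4
  ext π
  constructor
  · intro hπ i hi
    have := hπ i (by simpa using hi)
    simpa using this
  · intro hπ x hx
    have := hπ ⟨x, hQ hx⟩ (by simpa using hx)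
    simpa [Equiv.Perm.ofSubtype_apply_of_mem π (hQ hx)] using this

/-- The positions `a, …, a + b - 1` of a stream of length `n`, cut off at the end. -/
def window (n a b : ℕ) : Finset (Fin n) :=
  Finset.univ.filter fun i => a ≤ (i : ℕ) ∧ (i : ℕ) < a + b

theorem card_window (n a b : ℕ) : (window n a b).card = min n (a + b) - a := by
  have h : (window n a b).map Fin.valEmbedding = Finset.Ico a (min n (a + b)) := by
    ext i
    simp only [window, Finset.mem_map, Finset.mem_filter, Finset.mem_univ, true_and,
      Fin.valEmbedding_apply, Finset.mem_Ico]
    constructor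
    · rintro ⟨j, hj, rfl⟩
      have := j.isLt
      omega
    · rintro ⟨h1, h2⟩
      exact ⟨⟨i, by omega⟩, by simp; omega, rfl⟩
  rw [← Finset.card_map, h, Nat.card_Ico]

theorem toFinset_drop_take {X : Type*} [DecidableEq X] {n : ℕ} (σ : Fin n ≃ X) (a b : ℕ) :
    (((List.ofFn σ).drop a).take b).toFinset = (window n a b).map σ.toEmbedding := by
  ext x
  simp only [window, List.mem_toFinset, Finset.mem_map, Finset.mem_filter, Finset.mem_univ,
    true_and, Equiv.coe_toEmbedding, List.mem_iff_getElem, List.getElem_take, List.getElem_drop,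
    List.getElem_ofFn, List.length_take, List.length_drop, List.length_ofFn]
  constructor
  · rintro ⟨i, hi, rfl⟩
    exact ⟨⟨a + i, by omega⟩, ⟨by simp, by simp; omega⟩, rfl⟩
  · rintro ⟨i, ⟨h1, h2⟩, rfl⟩
    refine ⟨i - a, by have := i.isLt; omega, ?_⟩
    congr 1
    ext
    simp
    omega

/-- The Chernoff bound for the total weight of a window of a random stream. -/
theorem chernoff_window {X : Type*} [Fintype X] [DecidableEq X] {n : ℕ} (hn : 0 < n)
    {w : X → ℝ} (hw0 : ∀ x, 0 ≤ w x) (hw1 : ∀ x, w x ≤ 1) (a b : ℕ) {s t A : ℝ}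
    (hA : (window n a b).card * (∑ x, w x) * (Real.exp s - 1) ≤ A * n) :
    ({σ : Fin n ≃ X | s * t ≤
        s * ∑ x ∈ (((List.ofFn σ).drop a).take b).toFinset, w x}.ncard : ℝ) ≤
      Real.exp (A - s * t) * Nat.card (Fin n ≃ X) := by
  have : Nonempty (Fin n) := ⟨⟨0, hn⟩⟩
  simp only [toFinset_drop_take, Finset.sum_map, Equiv.coe_toEmbedding]
  exact chernoff hw0 hw1 (window n a b) (by simpa using hA)

/-! ### Nearest centers, risk, and furthest points -/

section Nearest

variable {X : Type*} [MetricSpace X] [LinearOrder X]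

theorem nearest_spec {T : Finset X} (hT : T.Nonempty) (x : X) :
    nearest T x ∈ T ∧ ∀ c' ∈ T, dist x (nearest T x) ≤ dist x c' := by
  classical
  have h : (T.filter fun c => ∀ c' ∈ T, dist x c ≤ dist x c').Nonempty := by
    obtain ⟨c, hc, hmin⟩ := T.exists_min_image (fun c => dist x c) hT
    exact ⟨c, by simpa using ⟨hc, hmin⟩⟩
  have hn : nearest T x = (T.filter fun c => ∀ c' ∈ T, dist x c ≤ dist x c').min' h := by
    unfold nearest
    rw [dif_pos h]
  rw [hn]
  exact Finset.mem_filter.1 (Finset.min'_mem _ h)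

theorem nearest_mem {T : Finset X} (hT : T.Nonempty) (x : X) : nearest T x ∈ T :=
  (nearest_spec hT x).1

theorem dist_nearest {T : Finset X} (hT : T.Nonempty) (x : X) :
    dist x (nearest T x) = Metric.infDist x (T : Set X) := by
  refine le_antisymm ((Metric.le_infDist (by simpa using hT)).2 fun y hy => ?_)
    (Metric.infDist_le_dist_of_mem (by simpa using nearest_mem hT x))
  exact (nearest_spec hT x).2 y (by simpa using hy)

end Nearest

section Risk

variable {X : Type*} [MetricSpace X]

theorem infDist_le_dist {T : Finset X} {y : X} (hy : y ∈ T) (x : X) :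
    Metric.infDist x (T : Set X) ≤ dist x y :=
  Metric.infDist_le_dist_of_mem (by simpa using hy)

theorem infDist_le_dist_add (T : Finset X) (x y : X) :
    Metric.infDist x (T : Set X) ≤ dist x y + Metric.infDist y (T : Set X) := by
  rw [add_comm]
  exact Metric.infDist_le_infDist_add_dist

theorem risk_nonneg (S T : Finset X) : 0 ≤ risk S T :=
  Finset.sum_nonneg fun _ _ => Metric.infDist_nonneg

theorem risk_mono {S S' : Finset X} (h : S ⊆ S') (T : Finset X) : risk S T ≤ risk S' T :=
  Finset.sum_le_sum_of_subset_of_nonneg h fun _ _ _ => Metric.infDist_nonneg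

/-- A cluster center is at most as far from `T'` as the points of any part `B` of its cluster are
on average, up to their own distance from the center. -/
theorem card_mul_infDist_le (B T' : Finset X) (c : X) :
    (B.card : ℝ) * Metric.infDist c (T' : Set X) ≤ ∑ x ∈ B, dist x c + risk B T' := by
  rw [risk, ← Finset.sum_add_distrib, ← nsmul_eq_mul]
  refine Finset.card_nsmul_le_sum _ _ _ fun x _ => ?_
  rw [dist_comm]
  exact infDist_le_dist_add T' c x

variable [Fintype X] [LinearOrder X]

@[simp] theorem mem_cluster {T : Finset X} {c x : X} : x ∈ cluster T c ↔ nearest T x = c := by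
  simp [cluster]

end Risk

section Far

variable {X : Type*} [MetricSpace X] [LinearOrder X]

/-- `y` precedes `x` when points are listed by decreasing distance from `T`, ties being broken by
the fixed order. -/
def Precedes (T : Finset X) (y x : X) : Prop :=
  Metric.infDist x (T : Set X) < Metric.infDist y (T : Set X) ∨
    (Metric.infDist x (T : Set X) = Metric.infDist y (T : Set X) ∧ y < x)

theorem Precedes.infDist_le {T : Finset X} {x y : X} (h : Precedes T y x) :
    Metric.infDist x (T : Set X) ≤ Metric.infDist y (T : Set X) := by
  rcases h with h | h
  · exact h.le
  · exact h.1.le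

theorem Precedes.trans {T : Finset X} {x y z : X} (h : Precedes T z y) (h' : Precedes T y x) :
    Precedes T z x := by
  unfold Precedes at *
  rcases h with h | ⟨h1, h2⟩ <;> rcases h' with h' | ⟨h1', h2'⟩
  · exact Or.inl (h'.trans h)
  · exact Or.inl (by rw [h1']; exact h)
  · exact Or.inl (by rw [← h1]; exact h')
  · exact Or.inr ⟨h1'.trans h1, h2.trans h2'⟩

theorem not_precedes_self (T : Finset X) (x : X) : ¬ Precedes T x x := by
  simp [Precedes]

theorem precedes_total (T : Finset X) {x y : X} (h : x ≠ y) : Precedes T x y ∨ Precedes T y x := by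
  unfold Precedes
  rcases lt_trichotomy (Metric.infDist x (T : Set X)) (Metric.infDist y (T : Set X)) with h1 | h1 | h1
  · exact Or.inr (Or.inl h1)
  · rcases lt_or_gt_of_ne h with h2 | h2
    · exact Or.inl (Or.inr ⟨h1.symm, h2⟩)
    · exact Or.inr (Or.inr ⟨h1, h2⟩)
  · exact Or.inl (Or.inl h1)

open Classical in
/-- The number of points of `S` that precede `x`. -/
noncomputable def rank (S T : Finset X) (x : X) : ℕ :=
  (S.filter fun y => Precedes T y x).card

theorem mem_far {r : ℕ} {S T : Finset X} {x : X} : x ∈ far r S T ↔ x ∈ S ∧ rank S T x < r := by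
  unfold far rank Precedes
  simp only [Finset.mem_filter]
  congr!

theorem rank_lt_rank {S T : Finset X} {x y : X} (hy : y ∈ S) (h : Precedes T y x) :
    rank S T y < rank S T x := by
  classical
  refine Finset.card_lt_card ((Finset.ssubset_iff_of_subset fun z hz => ?_).2 ⟨y, ?_, ?_⟩)
  · simp only [Finset.mem_filter] at hz ⊢
    exact ⟨hz.1, hz.2.trans h⟩
  · simpa using ⟨hy, h⟩
  · simp [not_precedes_self]

theorem rank_injOn (S T : Finset X) : Set.InjOn (rank S T) S := by
  intro x hx y hy hxy
  by_contra hne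
  rcases precedes_total T hne with h | h
  · exact absurd hxy (rank_lt_rank hx h).ne
  · exact absurd hxy (rank_lt_rank hy h).ne'

theorem rank_lt_card {S T : Finset X} {x : X} (hx : x ∈ S) : rank S T x < S.card := by
  classical
  refine Finset.card_lt_card ((Finset.ssubset_iff_of_subset (Finset.filter_subset _ _)).2
    ⟨x, hx, by simp [not_precedes_self]⟩)

theorem image_rank (S T : Finset X) : S.image (rank S T) = Finset.range S.card := by
  refine Finset.eq_of_subset_of_card_le ?_ ?_
  · intro i hi
    obtain ⟨x, hx, rfl⟩ := Finset.mem_image.1 hi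
    exact Finset.mem_range.2 (rank_lt_card hx)
  · rw [Finset.card_image_of_injOn (rank_injOn S T), Finset.card_range]

theorem far_subset (r : ℕ) (S T : Finset X) : far r S T ⊆ S := fun _ hx => (mem_far.1 hx).1

theorem card_far (r : ℕ) (S T : Finset X) : (far r S T).card = min r S.card := by
  rw [← Finset.card_image_of_injOn ((rank_injOn S T).mono (far_subset r S T)),
    ← Finset.card_range (min r S.card)]
  congr 1
  ext i
  have h := Finset.ext_iff.1 (image_rank S T) i
  simp only [Finset.mem_image, Finset.mem_range, mem_far, lt_min_iff] at h ⊢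
  constructor
  · rintro ⟨x, ⟨hx, hr⟩, rfl⟩
    exact ⟨hr, rank_lt_card hx⟩
  · rintro ⟨h1, h2⟩
    obtain ⟨x, hx, rfl⟩ := h.2 h2
    exact ⟨x, ⟨hx, h1⟩, rfl⟩

theorem infDist_le_of_mem_far {r : ℕ} {S T : Finset X} {x y : X} (hx : x ∈ far r S T)
    (hy : y ∈ S) (hy' : y ∉ far r S T) :
    Metric.infDist y (T : Set X) ≤ Metric.infDist x (T : Set X) := by
  have hne : y ≠ x := fun h => hy' (h ▸ hx)
  rcases precedes_total T hne with h | h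
  · exact absurd (mem_far.2 ⟨hy, (rank_lt_rank hy h).trans (mem_far.1 hx).2⟩) hy'
  · exact h.infDist_le

/-- Discarding the `r` furthest points is optimal among all ways of discarding `r` points. -/
theorem truncRisk_le {r : ℕ} {S T E : Finset X} (hE : (S ∩ E).card ≤ r) :
    truncRisk r S T ≤ risk (S \ E) T := by
  unfold truncRisk risk
  set f : X → ℝ := fun x => Metric.infDist x (T : Set X)
  set G := far r S T with hG
  have hcard : ((S \ G) \ (S \ E)).card ≤ ((S \ E) \ (S \ G)).card := by
    rcases le_total S.card r with h | h
    · have : G = S := by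
        refine Finset.eq_of_subset_of_card_le (far_subset r S T) ?_
        rw [card_far]
        omega
      simp [this]
    · have h1 : G.card = r := by rw [hG, card_far]; omega
      have h2 := Finset.card_sdiff_add_card_inter (S \ G) (S \ E)
      have h3 := Finset.card_sdiff_add_card_inter (S \ E) (S \ G)
      have h4 := Finset.card_sdiff_add_card_inter S E
      have h5 := Finset.card_sdiff_add_card_inter S G
      have h6 : S ∩ G = G := Finset.inter_eq_right.2 (far_subset r S T)
      rw [Finset.inter_comm] at h3
      rw [h6] at h5
      omega
  -- the points kept by `far` only are dominated by those kept by the competitor only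
  have hle : ∑ x ∈ (S \ G) \ (S \ E), f x ≤ ∑ x ∈ (S \ E) \ (S \ G), f x := by
    rcases ((S \ E) \ (S \ G)).eq_empty_or_nonempty with h0 | h0
    · have : (S \ G) \ (S \ E) = ∅ := by
        rw [← Finset.card_eq_zero]
        rw [h0] at hcard
        simpa using hcard
      rw [h0, this]
    · obtain ⟨a, ha, hmin⟩ := Finset.exists_min_image _ f h0
      have ha' : a ∈ G := by
        simp only [Finset.mem_sdiff, not_and, not_not] at ha
        exact ha.2 ha.1.1
      calc ∑ x ∈ (S \ G) \ (S \ E), f x ≤ ((S \ G) \ (S \ E)).card • f a := by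
            refine Finset.sum_le_card_nsmul _ _ _ fun x hx => ?_
            simp only [Finset.mem_sdiff] at hx
            exact infDist_le_of_mem_far ha' hx.1.1 hx.1.2
        _ ≤ ((S \ E) \ (S \ G)).card • f a := by
            simp only [nsmul_eq_mul]
            exact mul_le_mul_of_nonneg_right (by exact_mod_cast hcard) Metric.infDist_nonneg
        _ ≤ _ := Finset.card_nsmul_le_sum _ _ _ fun x hx => hmin x hx
  rw [← Finset.sum_inter_add_sum_sdiff (S \ G) (S \ E),
    ← Finset.sum_inter_add_sum_sdiff (S \ E) (S \ G), Finset.inter_comm (S \ E)]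
  linarith

/-- A set of points beyond a distance threshold is a prefix of the list by decreasing distance, so
it contains or is contained in the set of the `J` furthest points, according to its size. -/
theorem far_subset_filter {J : ℕ} {S T : Finset X} {θ : ℝ}
    (h : J ≤ (S.filter fun x => θ < Metric.infDist x (T : Set X)).card) :
    far J S T ⊆ S.filter fun x => θ < Metric.infDist x (T : Set X) := by
  classical
  intro x hx
  obtain ⟨hxS, hr⟩ := mem_far.1 hx
  refine Finset.mem_filter.2 ⟨hxS, ?_⟩
  by_contra hθ
  refine absurd hr (not_lt.2 (h.trans (Finset.card_le_card fun y hy => ?_)))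
  simp only [Finset.mem_filter] at hy ⊢
  exact ⟨hy.1, Or.inl ((not_lt.1 hθ).trans_lt hy.2)⟩

theorem filter_subset_far {J : ℕ} {S T : Finset X} {θ : ℝ}
    (h : (S.filter fun x => θ < Metric.infDist x (T : Set X)).card ≤ J) :
    (S.filter fun x => θ < Metric.infDist x (T : Set X)) ⊆ far J S T := by
  classical
  intro x hx
  have hx' := Finset.mem_filter.1 hx
  refine mem_far.2 ⟨hx'.1, lt_of_lt_of_le (Finset.card_lt_card
    ((Finset.ssubset_iff_of_subset fun y hy => ?_).2 ⟨x, hx, ?_⟩)) h⟩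
  · simp only [Finset.mem_filter] at hy ⊢
    exact ⟨hy.1, hx'.2.trans_le hy.2.infDist_le⟩
  · simp [not_precedes_self]

/-- Markov's inequality for the truncated risk. It is strict, which matters for `θ = 0`. -/
theorem card_filter_mul_lt_truncRisk {r : ℕ} {S T : Finset X} {θ : ℝ} (hθ : 0 ≤ θ)
    (hr : r < (S.filter fun x => θ < Metric.infDist x (T : Set X)).card) :
    (((S.filter fun x => θ < Metric.infDist x (T : Set X)).card : ℝ) - r) * θ <
      truncRisk r S T := by
  set W := S.filter fun x => θ < Metric.infDist x (T : Set X) with hW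
  have h0 : W.card ≤ (W \ far r S T).card + r := by
    have := Finset.card_sdiff_add_card_inter W (far r S T)
    have h2 : (W ∩ far r S T).card ≤ r :=
      (Finset.card_le_card Finset.inter_subset_right).trans (by rw [card_far]; exact min_le_left _ _)
    omega
  have h1 : (W.card : ℝ) - r ≤ (W \ far r S T).card := by
    rw [sub_le_iff_le_add]
    exact_mod_cast h0
  have hne : (W \ far r S T).Nonempty := by
    rw [← Finset.card_pos]
    omega
  calc ((W.card : ℝ) - r) * θ ≤ (W \ far r S T).card * θ := mul_le_mul_of_nonneg_right h1 hθ
    _ = ∑ _x ∈ W \ far r S T, θ := by rw [Finset.sum_const, nsmul_eq_mul]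
    _ < risk (W \ far r S T) T := Finset.sum_lt_sum_of_nonempty hne fun x hx =>
        (Finset.mem_filter.1 (Finset.mem_sdiff.1 hx).1).2
    _ ≤ truncRisk r S T :=
        risk_mono (Finset.sdiff_subset_sdiff (Finset.filter_subset _ _) subset_rfl) T

end Far

/-! ### The selection process -/

section Selection

variable {X : Type*} [MetricSpace X] [LinearOrder X]

/-- The state in which the third phase starts. -/
def initState (X : Type*) : SelectState X :=
  { selected := ∅, count := fun _ => 0, near := fun _ => false }

/-- The state after the points of `l` have been read. -/
noncomputable def run (T : Finset X) (θ : ℝ) (M : ℕ) (l : List X) : SelectState X :=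
  l.foldl (selectStep T θ M) (initState X)

variable {T : Finset X} {θ : ℝ} {M : ℕ}

theorem run_append_singleton (l : List X) (x : X) :
    run T θ M (l ++ [x]) = selectStep T θ M (run T θ M l) x := by
  simp [run]

theorem selectStep_of_select {s : SelectState X} {x : X}
    (h : θ < dist x (nearest T x) ∨ s.count (nearest T x) < M ∨ s.near (nearest T x) = false) :
    selectStep T θ M s x =
      { selected := insert x s.selected
        count := Function.update s.count (nearest T x) (s.count (nearest T x) + 1)
        near := if dist x (nearest T x) ≤ θ then Function.update s.near (nearest T x) true
          else s.near } := by
  unfold selectStep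
  simp only [if_pos h]

theorem selectStep_of_not_select {s : SelectState X} {x : X}
    (h : ¬ (θ < dist x (nearest T x) ∨ s.count (nearest T x) < M ∨
      s.near (nearest T x) = false)) : selectStep T θ M s x = s := by
  unfold selectStep
  simp only [if_neg h]

theorem selected_subset_selectStep (s : SelectState X) (x : X) :
    s.selected ⊆ (selectStep T θ M s x).selected := by
  by_cases h : θ < dist x (nearest T x) ∨ s.count (nearest T x) < M ∨ s.near (nearest T x) = false
  · rw [selectStep_of_select h]
    exact Finset.subset_insert _ _
  · rw [selectStep_of_not_select h]

theorem run_selected_subset (l : List X) : (run T θ M l).selected ⊆ l.toFinset := by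
  induction l using List.reverseRecOn with
  | nil => simp [run, initState]
  | append_singleton l x ih =>
    rw [run_append_singleton]
    have hl : l.toFinset ⊆ (l ++ [x]).toFinset := by
      intro y
      simp +contextual
    by_cases h : θ < dist x (nearest T x) ∨ (run T θ M l).count (nearest T x) < M ∨
        (run T θ M l).near (nearest T x) = false
    · rw [selectStep_of_select h]
      exact Finset.insert_subset (by simp) (ih.trans hl)
    · rw [selectStep_of_not_select h]
      exact ih.trans hl

theorem exists_of_run_near (l : List X) (c : X) (h : (run T θ M l).near c = true) :
    ∃ y ∈ (run T θ M l).selected, dist y c ≤ θ := by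
  induction l using List.reverseRecOn with
  | nil => simp [run, initState] at h
  | append_singleton l x ih =>
    rw [run_append_singleton] at h ⊢
    have hsub := selected_subset_selectStep (T := T) (θ := θ) (M := M) (run T θ M l) x
    by_cases hc : (run T θ M l).near c = true
    · obtain ⟨y, hy, hd⟩ := ih hc
      exact ⟨y, hsub hy, hd⟩
    · by_cases hs : θ < dist x (nearest T x) ∨ (run T θ M l).count (nearest T x) < M ∨
          (run T θ M l).near (nearest T x) = false
      · rw [selectStep_of_select hs] at h ⊢
        simp only at h
        split_ifs at h with hd
        · by_cases hcx : c = nearest T x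
          · subst hcx
            exact ⟨x, Finset.mem_insert_self _ _, hd⟩
          · rw [Function.update_of_ne hcx] at h
            exact absurd h hc
        · exact absurd h hc
      · rw [selectStep_of_not_select hs] at h
        exact absurd h hc

/-- Every point that was read is selected or shares its center with a selected point, both being
within distance `θ` of that center. -/
theorem mem_selected_or_near (l : List X) {x : X} (hx : x ∈ l) :
    x ∈ (run T θ M l).selected ∨
      (dist x (nearest T x) ≤ θ ∧ ∃ y ∈ (run T θ M l).selected, dist y (nearest T x) ≤ θ) := by
  induction l using List.reverseRecOn with
  | nil => simp at hx
  | append_singleton l z ih =>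
    rw [run_append_singleton]
    have hsub := selected_subset_selectStep (T := T) (θ := θ) (M := M) (run T θ M l) z
    rcases List.mem_append.1 hx with hxl | hxz
    · rcases ih hxl with h | ⟨h1, y, hy, h2⟩
      · exact Or.inl (hsub h)
      · exact Or.inr ⟨h1, y, hsub hy, h2⟩
    · obtain rfl : x = z := by simpa using hxz
      by_cases hs : θ < dist x (nearest T x) ∨ (run T θ M l).count (nearest T x) < M ∨
          (run T θ M l).near (nearest T x) = false
      · left
        rw [selectStep_of_select hs]
        exact Finset.mem_insert_self _ _
      · rw [selectStep_of_not_select hs]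
        push Not at hs
        exact Or.inr ⟨hs.1, exists_of_run_near l _ (by simpa using hs.2.2)⟩

theorem run_count_le (l : List X) (c : X) :
    (run T θ M l).count c ≤ (l.filter fun x => nearest T x = c).length := by
  induction l using List.reverseRecOn with
  | nil => simp [run, initState]
  | append_singleton l x ih =>
    rw [run_append_singleton, List.filter_append, List.length_append]
    by_cases hs : θ < dist x (nearest T x) ∨ (run T θ M l).count (nearest T x) < M ∨
        (run T θ M l).near (nearest T x) = false
    · rw [selectStep_of_select hs]
      by_cases hc : c = nearest T x
      · subst hc
        simpa using ih
      · simp only [Function.update_of_ne hc]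
        omega
    · rw [selectStep_of_not_select hs]
      omega

/-- The first `M` points of each cell are selected. -/
theorem mem_selected_of_mem_take (l : List X) (c : X) {x : X}
    (hx : x ∈ (l.filter fun x => nearest T x = c).take M) : x ∈ (run T θ M l).selected := by
  induction l using List.reverseRecOn with
  | nil => simp at hx
  | append_singleton l z ih =>
    rw [run_append_singleton]
    have hsub := selected_subset_selectStep (T := T) (θ := θ) (M := M) (run T θ M l) z
    rw [List.filter_append, List.take_append, List.mem_append] at hx
    rcases hx with hx | hx
    · exact hsub (ih hx)
    · by_cases hz : nearest T z = c
      · simp only [hz, decide_true, List.filter_cons_of_pos, List.filter_nil] at hx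
        have hxz : x = z := by simpa using List.mem_of_mem_take hx
        have hM : (l.filter fun x => nearest T x = c).length < M := by
          by_contra hM
          have : M - (l.filter fun x => nearest T x = c).length = 0 := by omega
          simp [this] at hx
        subst hxz
        have hs : (run T θ M l).count (nearest T x) < M := by
          rw [hz]
          exact (run_count_le l c).trans_lt hM
        rw [selectStep_of_select (Or.inr (Or.inl hs))]
        exact Finset.mem_insert_self _ _
      · simp [hz] at hx

/-- At most `M + 1` points within distance `θ` of a given center are selected: at most `M` while
fewer than `M` points are associated with the center, and one more when no close point has been
selected before. -/
theorem card_near_selected (l : List X) (c : X) :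
    ((run T θ M l).selected.filter fun x => nearest T x = c ∧ dist x c ≤ θ).card ≤ M + 1 := by
  suffices H : ((run T θ M l).selected.filter fun x => nearest T x = c ∧ dist x c ≤ θ).card ≤
        (run T θ M l).count c ∧
      ((run T θ M l).near c = false →
        ((run T θ M l).selected.filter fun x => nearest T x = c ∧ dist x c ≤ θ) = ∅) ∧
      ((run T θ M l).selected.filter fun x => nearest T x = c ∧ dist x c ≤ θ).card ≤ M + 1 from
    H.2.2
  induction l using List.reverseRecOn with
  | nil => simp [run, initState]
  | append_singleton l x ih =>
    rw [run_append_singleton]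
    set s := run T θ M l with hsdef
    obtain ⟨h1, h2, h3⟩ := ih
    by_cases hs : θ < dist x (nearest T x) ∨ s.count (nearest T x) < M ∨
        s.near (nearest T x) = false
    · rw [selectStep_of_select hs]
      simp only [Finset.filter_insert]
      by_cases hc : nearest T x = c
      · rw [hc] at hs ⊢
        by_cases hd : dist x c ≤ θ
        · simp only [hd, and_self, if_true, Function.update_self]
          refine ⟨(Finset.card_insert_le _ _).trans (by omega), by simp, ?_⟩
          rcases hs with hs | hs | hs
          · exact absurd hd (not_le.2 hs)
          · exact (Finset.card_insert_le _ _).trans (by omega)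
          · rw [h2 hs]
            simp
        · simp only [hd, and_false, if_false, Function.update_self]
          exact ⟨h1.trans (Nat.le_succ _), h2, h3⟩
      · simp only [hc, false_and, if_false, Function.update_of_ne (Ne.symm hc)]
        refine ⟨h1, ?_, h3⟩
        split_ifs
        · rwa [Function.update_of_ne (Ne.symm hc)]
        · exact h2
    · rw [selectStep_of_not_select hs]
      exact ⟨h1, h2, h3⟩

theorem card_selected_le (hT : T.Nonempty) (l : List X) :
    (run T θ M l).selected.card ≤
      (l.toFinset.filter fun x => θ < Metric.infDist x (T : Set X)).card + T.card * (M + 1) := by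
  classical
  have hsub : (run T θ M l).selected ⊆
      (l.toFinset.filter fun x => θ < Metric.infDist x (T : Set X)) ∪
        T.biUnion fun c => (run T θ M l).selected.filter fun x => nearest T x = c ∧ dist x c ≤ θ := by
    intro x hx
    by_cases h : θ < Metric.infDist x (T : Set X)
    · exact Finset.mem_union_left _ (Finset.mem_filter.2 ⟨run_selected_subset l hx, h⟩)
    · refine Finset.mem_union_right _ (Finset.mem_biUnion.2
        ⟨nearest T x, nearest_mem hT x, Finset.mem_filter.2 ⟨hx, rfl, ?_⟩⟩)
      rw [dist_nearest hT]
      exact not_lt.1 h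
  refine (Finset.card_le_card hsub).trans ((Finset.card_union_le _ _).trans ?_)
  exact Nat.add_le_add_left (Finset.card_biUnion_le_card_mul _ _ _
    fun c _ => card_near_selected l c) _

end Selection

/-! ### Cost of moving clusters, reference clustering, cells -/

theorem exists_isOptimal {X : Type*} [MetricSpace X] {P : Finset X} (hP : P.Nonempty) {K : ℕ} (hK : 1 ≤ K) :
    ∃ T, IsOptimal P P K T := by
  obtain ⟨p, hp⟩ := hP
  have hne : (P.powerset.filter fun T => T.Nonempty ∧ T.card ≤ K).Nonempty :=
    ⟨{p}, by simpa using ⟨hp, hK⟩⟩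
  obtain ⟨T, hT, hmin⟩ := Finset.exists_min_image _ (fun T => risk P T) hne
  simp only [Finset.mem_filter, Finset.mem_powerset] at hT hmin
  exact ⟨T, ⟨hT.1, hT.2.1, hT.2.2⟩, fun T' h1 h2 h3 => hmin T' ⟨h1, h2, h3⟩⟩

section Cells

variable {X : Type*} [MetricSpace X] [LinearOrder X]

/-- The points of `Q` whose closest center in `T` is `c`. -/
noncomputable def cell (Q T : Finset X) (c : X) : Finset X := Q.filter fun x => nearest T x = c

/-- Ten times the ratio between the cost of `c` on the points of `L` in its cell and the size of
the cell. At most a tenth of the cell can consist of points of `L` beyond this distance, and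
`1/10 + 1/4 = 7/20` is below `exp (-1)`. -/
noncomputable def cellRadius (Q T L : Finset X) (c : X) : ℝ :=
  10 * (∑ x ∈ cell Q T c ∩ L, dist x c) / (cell Q T c).card

theorem cellRadius_nonneg (Q T L : Finset X) (c : X) : 0 ≤ cellRadius Q T L c :=
  div_nonneg (mul_nonneg (by norm_num) (Finset.sum_nonneg fun _ _ => dist_nonneg)) (by positivity)

/-- The points of a cell that are further from its center than the radius of the cell. -/
noncomputable def cellOuter (Q T L : Finset X) (c : X) : Finset X :=
  (cell Q T c).filter fun x => cellRadius Q T L c < dist x c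

/-- When at most a quarter of a cell lies outside `L`, few points of the cell are beyond its
radius. -/
theorem card_cellOuter_le {Q T L : Finset X} {c : X}
    (h : 4 * (cell Q T c \ L).card ≤ (cell Q T c).card) :
    ((cellOuter Q T L c).card : ℝ) ≤ 7 / 20 * (cell Q T c).card := by
  set V := cell Q T c with hV
  set d := cellRadius Q T L c with hd
  set B := cellOuter Q T L c with hB
  rcases V.eq_empty_or_nonempty with h0 | h0
  · have : B = ∅ := by rw [hB, cellOuter, ← hV, h0, Finset.filter_empty]
    simp [this]
  have hVpos : (0 : ℝ) < V.card := by exact_mod_cast h0.card_pos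
  have h1 : (B \ L).card ≤ (V \ L).card :=
    Finset.card_le_card (Finset.sdiff_subset_sdiff (Finset.filter_subset _ _) subset_rfl)
  have h2 : ((B ∩ L).card : ℝ) ≤ V.card / 10 := by
    by_contra hlt
    push Not at hlt
    have hne : (B ∩ L).Nonempty := by
      rw [← Finset.card_pos]
      have : (0 : ℝ) < (B ∩ L).card := lt_trans (by positivity) hlt
      exact_mod_cast this
    have h3 : ((B ∩ L).card : ℝ) * d < ∑ x ∈ B ∩ L, dist x c := by
      rw [← nsmul_eq_mul, ← Finset.sum_const]
      exact Finset.sum_lt_sum_of_nonempty hne fun x hx =>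
        (Finset.mem_filter.1 (Finset.mem_inter.1 hx).1).2
    have h4 : ∑ x ∈ B ∩ L, dist x c ≤ ∑ x ∈ V ∩ L, dist x c :=
      Finset.sum_le_sum_of_subset_of_nonneg
        (Finset.inter_subset_inter_right (Finset.filter_subset _ _)) fun _ _ _ => dist_nonneg
    have h5 : ∑ x ∈ V ∩ L, dist x c = V.card / 10 * d := by
      rw [hd, cellRadius, ← hV]
      field_simp
    have h6 := mul_le_mul_of_nonneg_right hlt.le (cellRadius_nonneg Q T L c)
    rw [← hd] at h6
    linarith
  have h3 : ((B \ L).card : ℝ) ≤ V.card / 4 := by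
    rw [le_div_iff₀ (by norm_num)]
    exact_mod_cast (by omega : (B \ L).card * 4 ≤ V.card)
  have h4 : ((B \ L).card : ℝ) + (B ∩ L).card = B.card := by
    exact_mod_cast Finset.card_sdiff_add_card_inter B L
  linarith

end Cells

section Clusters

variable {X : Type*} [Fintype X] [MetricSpace X] [LinearOrder X]

/-- The union of the clusters of `T` whose centers belong to `O`. -/
noncomputable def clusterUnion (T O : Finset X) : Finset X :=
  Finset.univ.filter fun x => nearest T x ∈ O

@[simp] theorem mem_clusterUnion {T O : Finset X} {x : X} :
    x ∈ clusterUnion T O ↔ nearest T x ∈ O := by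
  simp [clusterUnion]

theorem sum_inter_cluster (T O S : Finset X) (g : X → ℝ) :
    ∑ c ∈ O, ∑ x ∈ S ∩ cluster T c, g x = ∑ x ∈ S ∩ clusterUnion T O, g x := by
  have hm : ∀ x ∈ S ∩ clusterUnion T O, nearest T x ∈ O := fun x hx =>
    mem_clusterUnion.1 (Finset.mem_inter.1 hx).2
  rw [← Finset.sum_fiberwise_of_maps_to hm g]
  refine Finset.sum_congr rfl fun c hc => Finset.sum_congr ?_ fun _ _ => rfl
  ext x
  simp only [Finset.mem_inter, mem_cluster, Finset.mem_filter, mem_clusterUnion]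
  constructor
  · rintro ⟨h1, rfl⟩
    exact ⟨⟨h1, hc⟩, rfl⟩
  · rintro ⟨⟨h1, -⟩, h2⟩
    exact ⟨h1, h2⟩

theorem sum_dist_cluster {T : Finset X} (hT : T.Nonempty) (S : Finset X) (c : X) :
    ∑ x ∈ S ∩ cluster T c, dist x c = risk (S ∩ cluster T c) T := by
  refine Finset.sum_congr rfl fun x hx => ?_
  have hx' := mem_cluster.1 (Finset.mem_inter.1 hx).2
  rw [← dist_nearest hT, hx']

/-- If `B` contains a fraction `η` of each cluster with center in `O`, then the cost of moving these
clusters from their centers to `T'` is controlled by the costs of `B`. -/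
theorem sum_card_mul_infDist_le {T O B : Finset X} (hT : T.Nonempty) (T' : Finset X) {η : ℝ}
    (hη : 0 < η) (hB : ∀ c ∈ O, η * (cluster T c).card ≤ ((B ∩ cluster T c).card : ℝ)) :
    ∑ c ∈ O, ((cluster T c).card : ℝ) * Metric.infDist c (T' : Set X) ≤
      1 / η * (risk (B ∩ clusterUnion T O) T + risk (B ∩ clusterUnion T O) T') := by
  have h1 : ∀ c ∈ O, ((cluster T c).card : ℝ) * Metric.infDist c (T' : Set X) ≤
      1 / η * (risk (B ∩ cluster T c) T + risk (B ∩ cluster T c) T') := by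
    intro c hc
    have h2 := card_mul_infDist_le (B ∩ cluster T c) T' c
    rw [sum_dist_cluster hT] at h2
    rw [one_div, inv_mul_eq_div, le_div_iff₀ hη]
    have h3 := mul_le_mul_of_nonneg_right (hB c hc)
      (Metric.infDist_nonneg (x := c) (s := (T' : Set X)))
    linarith
  refine (Finset.sum_le_sum h1).trans (le_of_eq ?_)
  rw [← Finset.mul_sum, Finset.sum_add_distrib]
  simp only [risk, sum_inter_cluster]

/-- The cost of `T'` on the clusters with center in `O` exceeds that of `T` by at most the cost of
moving the centers. -/
theorem risk_clusterUnion_le {T : Finset X} (hT : T.Nonempty) (O S T' : Finset X) :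
    risk (S ∩ clusterUnion T O) T' ≤ risk (S ∩ clusterUnion T O) T +
      ∑ c ∈ O, ((S ∩ cluster T c).card : ℝ) * Metric.infDist c (T' : Set X) := by
  unfold risk
  rw [← sum_inter_cluster, ← sum_inter_cluster, ← Finset.sum_add_distrib]
  refine Finset.sum_le_sum fun c _ => ?_
  rw [← nsmul_eq_mul, ← Finset.sum_const, ← Finset.sum_add_distrib]
  refine Finset.sum_le_sum fun x hx => ?_
  have hx' := mem_cluster.1 (Finset.mem_inter.1 hx).2
  rw [← dist_nearest hT, hx']
  exact infDist_le_dist_add T' x c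

/-- The offline algorithm, run with extra centers, pays only for the points outside `F`: the
points of `F` can be centers themselves, and replacing each center of `T` by the closest remaining
point of its cluster at most doubles the cost. -/
theorem risk_offline_le {A : Finset X → ℕ → Finset X} {β : ℝ} (hβ : 0 ≤ β)
    (hA : IsApproximation β A) {T : Finset X} (hT : T.Nonempty) {P : Finset X} (hP : P.Nonempty)
    (F : Finset X) {K : ℕ} (hK2 : 2 ≤ K) (hK : T.card + (P ∩ F).card ≤ K) :
    risk P (A P K) ≤ β * (2 * risk (P \ F) T) := by
  classical
  obtain ⟨O, hO⟩ := exists_isOptimal hP (by omega : 1 ≤ K)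
  refine (hA P K hK2 O hO).trans (mul_le_mul_of_nonneg_left ?_ hβ)
  set U := T.filter fun c => ((P \ F) ∩ cluster T c).Nonempty with hU
  have hch : ∀ c, ∃ g, c ∈ U → g ∈ (P \ F) ∩ cluster T c ∧
      ∀ x ∈ (P \ F) ∩ cluster T c, dist g c ≤ dist x c := by
    intro c
    by_cases hc : c ∈ U
    · obtain ⟨g, hg, hmin⟩ := Finset.exists_min_image _ (fun x => dist x c) (Finset.mem_filter.1 hc).2
      exact ⟨g, fun _ => ⟨hg, hmin⟩⟩
    · exact ⟨c, fun h => absurd h hc⟩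
  choose g hg using hch
  have hmemU : ∀ x ∈ P \ F, nearest T x ∈ U := fun x hx =>
    Finset.mem_filter.2 ⟨nearest_mem hT x, x, by simpa using Finset.mem_sdiff.1 hx⟩
  set T' := (P ∩ F) ∪ U.image g with hT'
  have hsub : T' ⊆ P := by
    refine Finset.union_subset Finset.inter_subset_left fun y hy => ?_
    obtain ⟨c, hc, rfl⟩ := Finset.mem_image.1 hy
    exact (Finset.mem_sdiff.1 (Finset.mem_inter.1 (hg c hc).1).1).1
  have hcard : T'.card ≤ K := by
    have h1 : T'.card ≤ (P ∩ F).card + (U.image g).card := Finset.card_union_le _ _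
    have h2 : (U.image g).card ≤ U.card := Finset.card_image_le
    have h3 : U.card ≤ T.card := Finset.card_filter_le _ _
    omega
  have hne : T'.Nonempty := by
    obtain ⟨p, hp⟩ := hP
    by_cases hpF : p ∈ F
    · exact ⟨p, Finset.mem_union_left _ (Finset.mem_inter.2 ⟨hp, hpF⟩)⟩
    · exact ⟨_, Finset.mem_union_right _
        (Finset.mem_image_of_mem g (hmemU p (Finset.mem_sdiff.2 ⟨hp, hpF⟩)))⟩
  refine (hO.2 T' hsub hne hcard).trans ?_
  have hzero : ∀ x ∈ P ∩ F, Metric.infDist x (T' : Set X) = 0 := fun x hx =>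
    Metric.infDist_zero_of_mem (by simpa [T'] using Or.inl (Finset.mem_inter.1 hx))
  unfold risk
  rw [← Finset.sum_inter_add_sum_sdiff P F, Finset.sum_eq_zero hzero, zero_add, Finset.mul_sum]
  refine Finset.sum_le_sum fun x hx => ?_
  have hc := hmemU x hx
  have h1 : g (nearest T x) ∈ T' := Finset.mem_union_right _ (Finset.mem_image_of_mem g hc)
  have h2 := (hg _ hc).2 x (Finset.mem_inter.2 ⟨hx, by simp⟩)
  have h3 := infDist_le_dist h1 x
  have h4 := dist_triangle_right x (g (nearest T x)) (nearest T x)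
  rw [← dist_nearest hT]
  linarith

/-- If the reference clustering `T'` was obtained from a sample that represents the clusters with
center in `O`, moving these clusters to `T'` costs little. -/
theorem sum_card_mul_infDist_reference_le {A : Finset X → ℕ → Finset X} {α β ρ : ℝ} (hα : 0 < α)
    (hβ : 0 ≤ β) (hA : IsApproximation β A) {T O P F : Finset X} (hT : T.Nonempty)
    (hP : P.Nonempty) {K : ℕ} (hK2 : 2 ≤ K) (hK : T.card + (P ∩ F).card ≤ K)
    (hO : ∀ c ∈ O, α / 2 * (cluster T c).card ≤ (((P \ F) ∩ cluster T c).card : ℝ))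
    (hρ : risk (P \ F) T ≤ 2 * α * ρ) :
    ∑ c ∈ O, ((cluster T c).card : ℝ) * Metric.infDist c (A P K : Set X) ≤ (4 + 8 * β) * ρ := by
  have h1 := sum_card_mul_infDist_le hT (A P K) (half_pos hα) hO
  have h2 := risk_offline_le hβ hA hT hP F hK2 hK
  have h3 : risk ((P \ F) ∩ clusterUnion T O) T ≤ risk (P \ F) T :=
    risk_mono Finset.inter_subset_left T
  have h4 : risk ((P \ F) ∩ clusterUnion T O) (A P K) ≤ risk P (A P K) :=
    risk_mono (Finset.inter_subset_left.trans Finset.sdiff_subset) _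
  have h5 := mul_le_mul_of_nonneg_left hρ hβ
  calc _ ≤ _ := h1
    _ ≤ 1 / (α / 2) * (2 * α * ρ + 2 * (β * (2 * α * ρ))) := by
        refine mul_le_mul_of_nonneg_left ?_ (by positivity)
        linarith
    _ = (4 + 8 * β) * ρ := by
        field_simp
        ring

/-- The truncated risk of `T'` on a sample `P`, when few points of `P` lie in `F` or outside the
clusters with center in `O`, and no such cluster is overrepresented in `P`. -/
theorem truncRisk_reference_le {T O P F T' : Finset X} (hT : T.Nonempty) {r : ℕ} {α ρ D : ℝ}
    (hα : 0 < α) (hr : (P ∩ F).card + (P \ clusterUnion T O).card ≤ r)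
    (hO : ∀ c ∈ O, ((P ∩ cluster T c).card : ℝ) ≤ 2 * α * (cluster T c).card)
    (hρ : risk (P \ F) T ≤ 2 * α * ρ)
    (hD : ∑ c ∈ O, ((cluster T c).card : ℝ) * Metric.infDist c (T' : Set X) ≤ D) :
    truncRisk r P T' ≤ 2 * α * (ρ + D) := by
  set E := F ∪ (clusterUnion T O)ᶜ with hE
  have hEr : (P ∩ E).card ≤ r := by
    rw [hE, Finset.inter_union_distrib_left]
    refine (Finset.card_union_le _ _).trans (le_trans (le_of_eq ?_) hr)
    rw [Finset.sdiff_eq_inter_compl]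
  refine (truncRisk_le hEr).trans ?_
  have hEq : P \ E = (P \ F) ∩ clusterUnion T O := by
    ext x
    simp [hE, and_assoc]
  rw [hEq]
  have h1 := risk_clusterUnion_le hT O (P \ F) T'
  have h2 : risk ((P \ F) ∩ clusterUnion T O) T ≤ risk (P \ F) T :=
    risk_mono Finset.inter_subset_left T
  have h3 : ∑ c ∈ O, (((P \ F) ∩ cluster T c).card : ℝ) * Metric.infDist c (T' : Set X) ≤
      2 * α * ∑ c ∈ O, ((cluster T c).card : ℝ) * Metric.infDist c (T' : Set X) := by
    rw [Finset.mul_sum]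
    refine Finset.sum_le_sum fun c hc => ?_
    rw [← mul_assoc]
    refine mul_le_mul_of_nonneg_right (le_trans ?_ (hO c hc)) Metric.infDist_nonneg
    exact_mod_cast Finset.card_le_card
      (Finset.inter_subset_inter_right Finset.sdiff_subset)
  have h4 := mul_le_mul_of_nonneg_left hD (by positivity : (0 : ℝ) ≤ 2 * α)
  linarith

theorem cell_eq (Q T : Finset X) (c : X) : cell Q T c = Q ∩ cluster T c := by
  ext x
  simp [cell]

/-- The risk of the selected points on `Q ∩ L`. In a cell with few points outside `L`, a selected
point within the radius of the cell serves all of its points; in the other cells the points of `L`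
are charged to those outside `L`. -/
theorem risk_selected_inter_le {Q T L U : Finset X} (hT : T.Nonempty) {θ : ℝ} (hθ : 0 ≤ θ)
    (hnear : ∀ x ∈ Q, x ∈ U ∨ ∃ y ∈ U, dist y (nearest T x) ≤ θ)
    (hgood : ∀ c ∈ T, 4 * (cell Q T c \ L).card ≤ (cell Q T c).card →
      ∀ x ∈ cell Q T c, x ∈ U ∨ ∃ y ∈ U, dist y c ≤ cellRadius Q T L c) :
    risk (Q ∩ L) U ≤ 11 * risk (Q ∩ L) T + 3 * θ * (Q \ L).card := by
  have htri : ∀ {x c : X} {d : ℝ}, 0 ≤ d → (x ∈ U ∨ ∃ y ∈ U, dist y c ≤ d) →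
      Metric.infDist x (U : Set X) ≤ dist x c + d := by
    rintro x c d hd (hx | ⟨y, hy, hyc⟩)
    · rw [Metric.infDist_zero_of_mem (by simpa using hx)]
      positivity
    · exact (infDist_le_dist hy x).trans ((dist_triangle_right x y c).trans (by linarith))
  have hcell : ∀ c ∈ T, risk (cell Q T c ∩ L) U ≤
      11 * risk (cell Q T c ∩ L) T + 3 * θ * (cell Q T c \ L).card := by
    intro c hc
    set V := cell Q T c with hV
    have hdist : ∑ x ∈ V ∩ L, dist x c = risk (V ∩ L) T := by
      refine Finset.sum_congr rfl fun x hx => ?_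
      rw [← dist_nearest hT, (Finset.mem_filter.1 (Finset.mem_inter.1 hx).1).2]
    have h0 := risk_nonneg (V ∩ L) T
    by_cases hg : 4 * (V \ L).card ≤ V.card
    · have h1 : risk (V ∩ L) U ≤ ∑ x ∈ V ∩ L, (dist x c + cellRadius Q T L c) :=
        Finset.sum_le_sum fun x hx => htri (cellRadius_nonneg Q T L c)
          (hgood c hc hg x (Finset.mem_inter.1 hx).1)
      rw [Finset.sum_add_distrib, hdist, Finset.sum_const, nsmul_eq_mul] at h1
      have h2 : ((V ∩ L).card : ℝ) * cellRadius Q T L c ≤ 10 * risk (V ∩ L) T := by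
        rw [cellRadius, ← hV, hdist]
        rcases V.eq_empty_or_nonempty with he | hne
        · simp [he, risk]
        have hVpos : (0 : ℝ) < V.card := by exact_mod_cast hne.card_pos
        rw [← mul_div_assoc, div_le_iff₀ hVpos, mul_comm]
        refine mul_le_mul_of_nonneg_left ?_ (by positivity)
        exact_mod_cast Finset.card_le_card Finset.inter_subset_left
      have h3 : 0 ≤ 3 * θ * ((V \ L).card : ℝ) := by positivity
      linarith
    · have h1 : risk (V ∩ L) U ≤ ∑ x ∈ V ∩ L, (dist x c + θ) :=
        Finset.sum_le_sum fun x hx => by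
          have hx' := Finset.mem_filter.1 (Finset.mem_inter.1 hx).1
          exact htri hθ (hx'.2 ▸ hnear x hx'.1)
      rw [Finset.sum_add_distrib, hdist, Finset.sum_const, nsmul_eq_mul] at h1
      have h2 := Finset.card_sdiff_add_card_inter V L
      have h3 : ((V ∩ L).card : ℝ) ≤ 3 * (V \ L).card := by
        exact_mod_cast (by omega : (V ∩ L).card ≤ 3 * (V \ L).card)
      have h4 := mul_le_mul_of_nonneg_right h3 hθ
      linarith
  have hfull : ∀ S : Finset X, S ∩ clusterUnion T T = S := fun S =>
    Finset.inter_eq_left.2 fun x _ => mem_clusterUnion.2 (nearest_mem hT x)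
  have split : ∀ (S : Finset X) (g : X → ℝ), ∑ c ∈ T, ∑ x ∈ S ∩ cluster T c, g x = ∑ x ∈ S, g x :=
    fun S g => by rw [sum_inter_cluster, hfull]
  have e1 : ∀ c, cell Q T c ∩ L = (Q ∩ L) ∩ cluster T c := fun c => by
    rw [cell_eq, Finset.inter_right_comm]
  have e2 : ∀ c, cell Q T c \ L = (Q \ L) ∩ cluster T c := fun c => by
    ext x
    simp [cell, and_right_comm]
  have hsum := Finset.sum_le_sum hcell
  rw [Finset.sum_add_distrib, ← Finset.mul_sum, ← Finset.mul_sum] at hsum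
  simp only [e1, e2, risk, split] at hsum
  have hc := split (Q \ L) fun _ => 1
  simp only [Finset.sum_const, nsmul_eq_mul, mul_one] at hc
  rw [hc] at hsum
  exact hsum

end Clusters

/-! ### Large clusters and deterministic bounds -/

section Parameters

/-- The term `log (32 k / δ)` that governs all failure probabilities. -/
noncomputable def logTerm (k : ℕ) (δ : ℝ) : ℝ := Real.log (32 * k / δ)

variable {k : ℕ} {δ : ℝ}

theorem kPlus_eq : kPlus k δ = k + 38 * logTerm k δ := rfl

theorem mul_phi {α : ℝ} (hα : 0 < α) : α * phi k δ α = 150 * logTerm k δ := by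
  rw [phi, logTerm]
  field_simp

theorem logTerm_eq (hk : 2 ≤ k) (hδ : 0 < δ) :
    logTerm k δ = 5 * Real.log 2 + Real.log (k / δ) := by
  have hk' : (0 : ℝ) < k := by exact_mod_cast (by omega : 0 < k)
  rw [logTerm, mul_div_assoc, Real.log_mul (by norm_num) (by positivity),
    show (32 : ℝ) = 2 ^ 5 by norm_num, Real.log_pow]
  norm_num

theorem log_two_le_log_div (hk : 2 ≤ k) (hδ : 0 < δ) (hδ1 : δ < 1) :
    Real.log 2 ≤ Real.log (k / δ) := by
  have hk' : (2 : ℝ) ≤ k := by exact_mod_cast hk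
  refine Real.log_le_log (by norm_num) (hk'.trans ?_)
  rw [le_div_iff₀ hδ]
  nlinarith

theorem four_le_logTerm (hk : 2 ≤ k) (hδ : 0 < δ) (hδ1 : δ < 1) : 4 ≤ logTerm k δ := by
  have h1 := log_two_le_log_div hk hδ hδ1
  have h2 := Real.log_two_gt_d9
  rw [logTerm_eq hk hδ]
  linarith

theorem exp_neg_logTerm (hk : 2 ≤ k) (hδ : 0 < δ) :
    Real.exp (-logTerm k δ) = δ / (32 * k) := by
  have hk' : (0 : ℝ) < k := by exact_mod_cast (by omega : 0 < k)
  rw [Real.exp_neg, logTerm, Real.exp_log (by positivity), inv_div]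

end Parameters

section LargeClusters

variable {X : Type*} [Fintype X] [MetricSpace X] [LinearOrder X]

open Classical in
/-- The centers of the large clusters. -/
noncomputable def largeCenters (k : ℕ) (δ α : ℝ) (OPT : Finset X) : Finset X :=
  OPT.filter fun c => phi k δ α ≤ ((cluster OPT c).card : ℝ)

theorem mem_largeCenters {k : ℕ} {δ α : ℝ} {OPT : Finset X} {c : X} :
    c ∈ largeCenters k δ α OPT ↔ c ∈ OPT ∧ phi k δ α ≤ ((cluster OPT c).card : ℝ) := by
  simp [largeCenters]

theorem largePoints_eq (k : ℕ) (δ α : ℝ) (OPT : Finset X) :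
    largePoints k δ α OPT = clusterUnion OPT (largeCenters k δ α OPT) := by
  ext x
  simp [largePoints, largeCenters]

/-- There are at most `k φ` points outside the large clusters. -/
theorem card_compl_largePoints_le {k : ℕ} {δ α : ℝ} {OPT : Finset X} (hT : OPT.Nonempty)
    (hcard : OPT.card ≤ k) (hφ : 0 ≤ phi k δ α) :
    (((clusterUnion OPT (largeCenters k δ α OPT))ᶜ).card : ℝ) ≤ k * phi k δ α := by
  classical
  set S := OPT.filter fun c => ¬ phi k δ α ≤ ((cluster OPT c).card : ℝ) with hS
  have hsub : (clusterUnion OPT (largeCenters k δ α OPT))ᶜ ⊆ S.biUnion (cluster OPT) := by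
    intro x hx
    rw [Finset.mem_compl, mem_clusterUnion, mem_largeCenters] at hx
    refine Finset.mem_biUnion.2 ⟨nearest OPT x, Finset.mem_filter.2 ⟨nearest_mem hT x, ?_⟩,
      by simp⟩
    exact fun h => hx ⟨nearest_mem hT x, h⟩
  calc (((clusterUnion OPT (largeCenters k δ α OPT))ᶜ).card : ℝ)
      ≤ ((S.biUnion (cluster OPT)).card : ℝ) := by exact_mod_cast Finset.card_le_card hsub
    _ ≤ ∑ c ∈ S, ((cluster OPT c).card : ℝ) := by exact_mod_cast Finset.card_biUnion_le
    _ ≤ S.card • phi k δ α := Finset.sum_le_card_nsmul _ _ _ fun c hc =>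
        (not_le.1 (Finset.mem_filter.1 hc).2).le
    _ ≤ k * phi k δ α := by
        rw [nsmul_eq_mul]
        refine mul_le_mul_of_nonneg_right ?_ hφ
        exact_mod_cast (Finset.card_filter_le _ _).trans hcard

end LargeClusters

section FarPoints

variable {X : Type*} [MetricSpace X] [LinearOrder X]

/-- The cost of the selected points on the cluster of a center that was read in the third phase. -/
theorem risk_cluster_selected_le {T : Finset X} {θ : ℝ} {M : ℕ} (hθ : 0 ≤ θ) (l : List X)
    (S : Finset X) {c : X} (hc : c ∈ l) :
    (run T θ M l).selected.Nonempty ∧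
      risk S (run T θ M l).selected ≤ risk S {c} + S.card * (2 * θ) := by
  obtain ⟨y, hy, hd⟩ : ∃ y ∈ (run T θ M l).selected, dist c y ≤ 2 * θ := by
    rcases mem_selected_or_near (T := T) (θ := θ) (M := M) l hc with h | ⟨h1, y, hy, h2⟩
    · exact ⟨c, h, by rw [dist_self]; positivity⟩
    · exact ⟨y, hy, (dist_triangle_right c y (nearest T c)).trans (by linarith)⟩
  refine ⟨⟨y, hy⟩, ?_⟩
  rw [← nsmul_eq_mul, ← Finset.sum_const, risk, risk, ← Finset.sum_add_distrib]
  refine Finset.sum_le_sum fun x _ => (infDist_le_dist hy x).trans ?_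
  simp only [Finset.coe_singleton, Metric.infDist_singleton]
  linarith [dist_triangle x c y]

/-- A bound on the number of far points in the sample `P₃`, deduced from their number in the sample
`P₂` by comparing both with the set of the `J` furthest points of `Y`. -/
theorem card_far_points_le {Y P₂ P₃ T : Finset X} {J : ℕ} {θ q B : ℝ} (hP₃ : P₃ ⊆ Y)
    (hq : ((P₂.filter fun x => θ < Metric.infDist x (T : Set X)).card : ℝ) ≤ q)
    (h₂ : J ≤ Y.card → q < ((P₂ ∩ far J Y T).card : ℝ))
    (h₃ : ((P₃ ∩ far J Y T).card : ℝ) ≤ B) :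
    ((P₃.filter fun x => θ < Metric.infDist x (T : Set X)).card : ℝ) ≤ B := by
  rcases le_total J (Y.filter fun x => θ < Metric.infDist x (T : Set X)).card with h | h
  · exfalso
    have h1 := h₂ (h.trans (Finset.card_filter_le _ _))
    have h2 : P₂ ∩ far J Y T ⊆ P₂.filter fun x => θ < Metric.infDist x (T : Set X) := by
      intro x hx
      have hx' := Finset.mem_inter.1 hx
      exact Finset.mem_filter.2 ⟨hx'.1, (Finset.mem_filter.1 (far_subset_filter h hx'.2)).2⟩
    have h3 : ((P₂ ∩ far J Y T).card : ℝ) ≤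
        ((P₂.filter fun x => θ < Metric.infDist x (T : Set X)).card : ℝ) := by
      exact_mod_cast Finset.card_le_card h2
    linarith
  · refine le_trans ?_ h₃
    have h2 : (P₃.filter fun x => θ < Metric.infDist x (T : Set X)) ⊆ P₃ ∩ far J Y T := by
      intro x hx
      have hx' := Finset.mem_filter.1 hx
      exact Finset.mem_inter.2 ⟨hx'.1, filter_subset_far h
        (Finset.mem_filter.2 ⟨hP₃ hx'.1, hx'.2⟩)⟩
    exact_mod_cast Finset.card_le_card h2

end FarPoints

section Deterministic

variable {X : Type*} [Fintype X] [MetricSpace X] [LinearOrder X]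

/-- The properties of the first two samples `P₁`, `P₂` that are needed. Here `F` is the set of the
points that are most expensive for `OPT`; outside `F`, the cost of `OPT` is represented by both
samples, and so are the large clusters. -/
structure GoodSamples (k : ℕ) (δ α : ℝ) (OPT F P₁ P₂ : Finset X) : Prop where
  heavy₁ : ((P₁ ∩ F).card : ℝ) ≤ 38 * logTerm k δ
  risk₁ : risk (P₁ \ F) OPT ≤ 2 * α * risk Finset.univ OPT
  heavy₂ : ((P₂ ∩ F).card : ℝ) ≤ 300 * logTerm k δ
  risk₂ : risk (P₂ \ F) OPT ≤ 2 * α * risk Finset.univ OPT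
  small₂ : ((P₂ \ clusterUnion OPT (largeCenters k δ α OPT)).card : ℝ) ≤ 2 * α * (k * phi k δ α)
  large₁ : ∀ c ∈ largeCenters k δ α OPT,
    4 / 5 * α * (cluster OPT c).card ≤ ((P₁ ∩ cluster OPT c).card : ℝ)
  large₂ : ∀ c ∈ largeCenters k δ α OPT,
    ((P₂ ∩ cluster OPT c).card : ℝ) ≤ 2 * α * (cluster OPT c).card

variable {k : ℕ} {δ α β : ℝ} {OPT F P₁ P₂ : Finset X} {A : Finset X → ℕ → Finset X}

theorem two_le_floor_kPlus (hk : 2 ≤ k) (hδ : 0 < δ) (hδ1 : δ < 1) : 2 ≤ ⌊kPlus k δ⌋₊ := by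
  have hL := four_le_logTerm hk hδ hδ1
  refine hk.trans (Nat.le_floor ?_)
  rw [kPlus_eq]
  linarith

/-- The cost of moving the large clusters to the reference clustering. -/
theorem GoodSamples.sum_card_mul_infDist_le (h : GoodSamples k δ α OPT F P₁ P₂) (hk : 2 ≤ k)
    (hδ : 0 < δ) (hδ1 : δ < 1) (hα : 0 < α) (hβ : 0 ≤ β) (hA : IsApproximation β A)
    (hT : OPT.Nonempty) (hcard : OPT.card ≤ k) (hP₁ : P₁.Nonempty) :
    ∑ c ∈ largeCenters k δ α OPT, ((cluster OPT c).card : ℝ) *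
      Metric.infDist c (A P₁ ⌊kPlus k δ⌋₊ : Set X) ≤ (4 + 8 * β) * risk Finset.univ OPT := by
  have hL := four_le_logTerm hk hδ hδ1
  refine sum_card_mul_infDist_reference_le hα hβ hA hT hP₁ (two_le_floor_kPlus hk hδ hδ1) (F := F)
    (Nat.le_floor ?_) (fun c hc => ?_) h.risk₁
  · have h1 := h.heavy₁
    have h2 : (OPT.card : ℝ) ≤ k := by exact_mod_cast hcard
    rw [kPlus_eq]
    push_cast
    linarith
  · have h1 := h.large₁ c hc
    have h2 := (mem_largeCenters.1 hc).2
    have h3 := mul_phi (k := k) (δ := δ) hα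
    have h4 := mul_le_mul_of_nonneg_left h2 hα.le
    have h5 : ((P₁ ∩ cluster OPT c).card : ℝ) ≤
        ((P₁ \ F) ∩ cluster OPT c).card + (P₁ ∩ F).card := by
      have : P₁ ∩ cluster OPT c ⊆ ((P₁ \ F) ∩ cluster OPT c) ∪ (P₁ ∩ F) := by
        intro x
        simp only [Finset.mem_inter, Finset.mem_union, Finset.mem_sdiff]
        tauto
      exact_mod_cast (Finset.card_le_card this).trans (Finset.card_union_le _ _)
    have h6 := h.heavy₁
    -- the heavy points make up at most `38/150` of the sampled part of a large cluster
    linarith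

/-- The risk estimate does not exceed the optimal risk by more than a constant factor. -/
theorem GoodSamples.truncRisk_le (h : GoodSamples k δ α OPT F P₁ P₂) (hk : 2 ≤ k)
    (hδ : 0 < δ) (hδ1 : δ < 1) (hα : 0 < α) (hβ : 0 ≤ β) (hA : IsApproximation β A)
    (hT : OPT.Nonempty) (hcard : OPT.card ≤ k) (hP₁ : P₁.Nonempty) :
    1 / (3 * α) * truncRisk ⌈2 * α * (k + 1) * phi k δ α⌉₊ P₂ (A P₁ ⌊kPlus k δ⌋₊) ≤
      (18 * β + 10) * risk Finset.univ OPT := by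
  have h1 := h.sum_card_mul_infDist_le hk hδ hδ1 hα hβ hA hT hcard hP₁
  have h2 := truncRisk_reference_le (F := F) (r := ⌈2 * α * (k + 1) * phi k δ α⌉₊) hT hα
    (by
      have h3 := h.heavy₂
      have h4 := h.small₂
      have h5 := mul_phi (k := k) (δ := δ) hα
      have h6 := Nat.le_ceil (2 * α * (k + 1) * phi k δ α)
      have h7 : 2 * α * (k + 1) * phi k δ α = 2 * α * (k * phi k δ α) + 2 * (α * phi k δ α) := by
        ring
      exact_mod_cast (by push_cast; linarith :
        (((P₂ ∩ F).card + (P₂ \ clusterUnion OPT (largeCenters k δ α OPT)).card : ℕ) : ℝ) ≤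
          (⌈2 * α * (k + 1) * phi k δ α⌉₊ : ℝ)))
    h.large₂ h.risk₂ h1
  have hR := risk_nonneg Finset.univ OPT
  rw [one_div, inv_mul_le_iff₀ (by positivity)]
  refine h2.trans ?_
  have : 0 ≤ α * risk Finset.univ OPT := by positivity
  nlinarith [mul_nonneg hβ this]

/-- The risk of the selected points on the large clusters. -/
theorem risk_large_selected_le {T O : Finset X} {θ R D ψ : ℝ} {M : ℕ} {l : List X}
    (hl : l.Nodup) (hOPT : OPT.Nonempty) (hT : T.Nonempty) (hθ : 0 ≤ θ)
    (hhalf : ∀ c ∈ O, 1 / 2 * ((cluster OPT c).card : ℝ) ≤ ((l.toFinset ∩ cluster OPT c).card : ℝ))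
    (hfirst : ∀ c ∈ T, 4 * (cell l.toFinset T c \ clusterUnion OPT O).card ≤
        (cell l.toFinset T c).card → M ≤ (cell l.toFinset T c).card →
        ∃ y ∈ (l.filter fun x => nearest T x = c).take M,
          y ∉ cellOuter l.toFinset T (clusterUnion OPT O) c)
    (hR : risk (clusterUnion OPT O) OPT ≤ R)
    (hD : ∑ c ∈ O, ((cluster OPT c).card : ℝ) * Metric.infDist c (T : Set X) ≤ D)
    (hψ : θ * ((clusterUnion OPT O)ᶜ.card : ℝ) ≤ ψ) :
    risk (clusterUnion OPT O) (run T θ M l).selected ≤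
      risk (clusterUnion OPT O) OPT + (24 * R + 22 * D + 6 * ψ) := by
  set Q := l.toFinset with hQ
  set L := clusterUnion OPT O with hL
  set U := (run T θ M l).selected with hU
  have h1 : risk (Q ∩ L) U ≤ 11 * risk (Q ∩ L) T + 3 * θ * (Q \ L).card := by
    refine risk_selected_inter_le hT hθ (fun x hx => ?_) fun c hc hg x hx => ?_
    · rcases mem_selected_or_near (T := T) (θ := θ) (M := M) l (List.mem_toFinset.1 hx) with
        h | ⟨-, h⟩
      · exact Or.inl h
      · exact Or.inr h
    · have hlen : (l.filter fun x => nearest T x = c).length = (cell Q T c).card := by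
        rw [← List.toFinset_card_of_nodup (hl.filter _), List.toFinset_filter]
        simp [cell, hQ]
      rcases lt_or_ge (cell Q T c).card M with hM | hM
      · left
        refine mem_selected_of_mem_take l c ?_
        rw [List.take_of_length_le (by omega)]
        have := Finset.mem_filter.1 hx
        simpa [hQ] using this
      · right
        obtain ⟨y, hy, hy'⟩ := hfirst c hc hg hM
        refine ⟨y, mem_selected_of_mem_take l c hy, ?_⟩
        by_contra hlt
        refine hy' (Finset.mem_filter.2 ⟨?_, not_le.1 hlt⟩)
        have := List.mem_of_mem_take hy
        simpa [cell, hQ] using this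
  have h2 : risk (Q ∩ L) T ≤ risk L T := risk_mono Finset.inter_subset_right T
  have h3 : risk L T ≤ risk L OPT + D := by
    have := risk_clusterUnion_le hOPT O Finset.univ T
    simp only [Finset.univ_inter] at this
    linarith
  have h4 := sum_card_mul_infDist_le hOPT U (by norm_num : (0 : ℝ) < 1 / 2) hhalf
  have h5 : risk (Q ∩ L) OPT ≤ risk L OPT := risk_mono Finset.inter_subset_right OPT
  have h6 : risk L U ≤ risk L OPT +
      ∑ c ∈ O, ((cluster OPT c).card : ℝ) * Metric.infDist c (U : Set X) := by
    have := risk_clusterUnion_le hOPT O Finset.univ U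
    simpa only [Finset.univ_inter] using this
  have h7 : θ * ((Q \ L).card : ℝ) ≤ ψ := by
    refine le_trans (mul_le_mul_of_nonneg_left ?_ hθ) hψ
    have : Q \ L ⊆ Lᶜ := fun x hx => Finset.mem_compl.2 (Finset.mem_sdiff.1 hx).2
    exact_mod_cast Finset.card_le_card this
  linarith

end Deterministic

/-! ### Tail bounds for a random stream -/

theorem sum_indicator_inter {X : Type*} [DecidableEq X] (P B : Finset X) :
    ∑ x ∈ P, (if x ∈ B then (1 : ℝ) else 0) = ((P ∩ B).card : ℝ) := by
  simp

section Tails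

variable {X : Type*} [Fintype X] [DecidableEq X] {n : ℕ}

theorem upper_tail (hn : 0 < n) {w : X → ℝ} (hw0 : ∀ x, 0 ≤ w x) (hw1 : ∀ x, w x ≤ 1) (a b : ℕ)
    {t Λ : ℝ} (hA : (window n a b).card * (∑ x, w x) * (Real.exp 1 - 1) ≤ (t - Λ) * n) :
    ({σ : Fin n ≃ X | t < ∑ x ∈ (((List.ofFn σ).drop a).take b).toFinset, w x}.ncard : ℝ) ≤
      Real.exp (-Λ) * Nat.card (Fin n ≃ X) := by
  have h := chernoff_window hn hw0 hw1 a b (t := t) hA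
  rw [show t - Λ - 1 * t = -Λ by ring] at h
  refine le_trans ?_ h
  exact_mod_cast Set.ncard_le_ncard (fun σ hσ => by
    have : t < _ := hσ
    simpa using this.le) (Set.toFinite _)

theorem one_sub_exp_neg_quarter : 109 / 500 ≤ 1 - Real.exp (-(1 / 4)) := by
  have h1 := Real.quadratic_le_exp_of_nonneg (by norm_num : (0 : ℝ) ≤ 1 / 4)
  rw [Real.exp_neg]
  have h2 : (Real.exp (1 / 4))⁻¹ ≤ (1 + 1 / 4 + (1 / 4) ^ 2 / 2 : ℝ)⁻¹ :=
    inv_anti₀ (by norm_num) h1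
  norm_num at h2
  linarith

theorem lower_tail (hn : 0 < n) {w : X → ℝ} (hw0 : ∀ x, 0 ≤ w x) (hw1 : ∀ x, w x ≤ 1) (a b : ℕ)
    {t Λ : ℝ} (hA : (t / 4 + Λ) * n ≤ (window n a b).card * (∑ x, w x) * (109 / 500)) :
    ({σ : Fin n ≃ X | ∑ x ∈ (((List.ofFn σ).drop a).take b).toFinset, w x < t}.ncard : ℝ) ≤
      Real.exp (-Λ) * Nat.card (Fin n ≃ X) := by
  have hW : 0 ≤ (window n a b).card * (∑ x, w x) :=
    mul_nonneg (by positivity) (Finset.sum_nonneg fun x _ => hw0 x)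
  have h := chernoff_window hn hw0 hw1 a b (s := -(1 / 4)) (t := t) (A := -(t / 4 + Λ))
    (by nlinarith [one_sub_exp_neg_quarter])
  rw [show -(t / 4 + Λ) - -(1 / 4) * t = -Λ by ring] at h
  refine le_trans ?_ h
  exact_mod_cast Set.ncard_le_ncard (fun σ hσ => by
    have : _ < t := hσ
    rw [Set.mem_ofPred_eq]
    linarith) (Set.toFinite _)

theorem upper_tail_card (hn : 0 < n) (B : Finset X) (a b : ℕ)
    {t Λ : ℝ} (hA : (window n a b).card * (B.card : ℝ) * (Real.exp 1 - 1) ≤ (t - Λ) * n) :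
    ({σ : Fin n ≃ X | t < (((((List.ofFn σ).drop a).take b).toFinset ∩ B).card : ℝ)}.ncard : ℝ) ≤
      Real.exp (-Λ) * Nat.card (Fin n ≃ X) := by
  simp only [← sum_indicator_inter]
  exact upper_tail hn (fun x => by split_ifs <;> norm_num) (fun x => by split_ifs <;> norm_num) a b
    (by simpa using hA)

theorem lower_tail_card (hn : 0 < n) (B : Finset X) (a b : ℕ)
    {t Λ : ℝ} (hA : (t / 4 + Λ) * n ≤ (window n a b).card * (B.card : ℝ) * (109 / 500)) :
    ({σ : Fin n ≃ X | (((((List.ofFn σ).drop a).take b).toFinset ∩ B).card : ℝ) < t}.ncard : ℝ) ≤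
      Real.exp (-Λ) * Nat.card (Fin n ≃ X) := by
  simp only [← sum_indicator_inter]
  exact lower_tail hn (fun x => by split_ifs <;> norm_num) (fun x => by split_ifs <;> norm_num) a b
    (by simpa using hA)

end Tails

section Streams

variable {X : Type*}

theorem ofFn_trans {n : ℕ} (σ : Fin n ≃ X) (f : Equiv.Perm X) :
    List.ofFn (σ.trans f) = (List.ofFn σ).map f := by
  rw [List.map_ofFn]
  rfl

theorem phase1_map (n : ℕ) (α : ℝ) (l : List X) (f : X → X) :
    phase1 n α (l.map f) = (phase1 n α l).map f := by
  simp [phase1, List.map_take]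

theorem phase3_map (n : ℕ) (α γ : ℝ) (l : List X) (f : X → X) :
    phase3 n α γ (l.map f) = (phase3 n α γ l).map f := by
  simp [phase3, List.map_take, List.map_drop]

theorem map_ofSubtype_eq_self [DecidableEq X] {V : Finset X} (π : Equiv.Perm V) {l : List X}
    (h : ∀ x ∈ l, x ∉ V) : l.map (Equiv.Perm.ofSubtype π) = l := by
  refine (List.map_congr_left fun x hx => ?_).trans (List.map_id l)
  exact Equiv.Perm.ofSubtype_apply_of_not_mem π (h x hx)

theorem ofSubtype_mem_iff [DecidableEq X] {V S : Finset X} (hV : V ⊆ S) (π : Equiv.Perm V)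
    (x : X) : Equiv.Perm.ofSubtype π x ∈ S ↔ x ∈ S := by
  by_cases hx : x ∈ V
  · rw [Equiv.Perm.ofSubtype_apply_of_mem π hx]
    exact ⟨fun _ => hV hx, fun _ => hV (π ⟨x, hx⟩).2⟩
  · rw [Equiv.Perm.ofSubtype_apply_of_not_mem π hx]

theorem image_ofSubtype_of_subset [DecidableEq X] {V S : Finset X} (hV : V ⊆ S)
    (π : Equiv.Perm V) : S.image (Equiv.Perm.ofSubtype π) = S := by
  refine Finset.eq_of_subset_of_card_le (fun y hy => ?_) ?_
  · obtain ⟨x, hx, rfl⟩ := Finset.mem_image.1 hy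
    exact (ofSubtype_mem_iff hV π x).2 hx
  · rw [Finset.card_image_of_injective _ (Equiv.injective _)]

theorem nodup_ofFn {n : ℕ} (σ : Fin n ≃ X) : (List.ofFn σ).Nodup :=
  List.nodup_ofFn.2 σ.injective

theorem not_mem_phase1 {n a b : ℕ} {α : ℝ} {σ : Fin n ≃ X} (ha : ⌈α * n⌉₊ ≤ a) {x : X}
    (hx : x ∈ ((List.ofFn σ).drop a).take b) : x ∉ phase1 n α (List.ofFn σ) := by
  intro h
  exact List.disjoint_take_drop (nodup_ofFn σ) ha h (List.mem_of_mem_take hx)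

theorem toFinset_map [DecidableEq X] (l : List X) (f : X → X) :
    (l.map f).toFinset = l.toFinset.image f := by
  ext x
  simp

theorem phase1_trans_of_disjoint [DecidableEq X] {n : ℕ} {α : ℝ} (σ : Fin n ≃ X) {V : Finset X}
    (hV : ∀ x ∈ V, x ∉ phase1 n α (List.ofFn σ)) (π : Equiv.Perm V) :
    phase1 n α (List.ofFn (σ.trans (Equiv.Perm.ofSubtype π))) = phase1 n α (List.ofFn σ) := by
  rw [ofFn_trans, phase1_map]
  exact map_ofSubtype_eq_self π fun x hx hx' => hV x hx' hx

theorem refClustering_congr [LinearOrder X] {A : Finset X → ℕ → Finset X} {δ α : ℝ} {k n : ℕ} {l l' : List X}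
    (h : phase1 n α l = phase1 n α l') :
    refClustering A δ k n α l = refClustering A δ k n α l' := by
  rw [refClustering, refClustering, h]

/-- The points that are not read in the first phase. -/
noncomputable def unread [Fintype X] [DecidableEq X] {n : ℕ} (α : ℝ) (σ : Fin n ≃ X) : Finset X :=
  (phase1 n α (List.ofFn σ)).toFinsetᶜ

theorem card_unread [Fintype X] [DecidableEq X] {n : ℕ} {α : ℝ} (σ : Fin n ≃ X) (hm : ⌈α * n⌉₊ ≤ n) :
    (unread α σ).card = n - ⌈α * n⌉₊ := by
  have h : Fintype.card X = n := by simpa using (Fintype.card_congr σ).symm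
  rw [unread, phase1, Finset.card_compl, h, List.toFinset_card_of_nodup
    ((nodup_ofFn σ).sublist (List.take_sublist _ _))]
  simp [hm]

end Streams

section Conditional

variable {X : Type*} [Fintype X] [MetricSpace X] [LinearOrder X]

/-- The Chernoff bound, conditionally on the first phase, for the number of points of a later
window among the `J` unread points that are furthest from the reference clustering. -/
theorem chernoff_far (A : Finset X → ℕ → Finset X) (δ : ℝ) (k : ℕ) {n : ℕ} {α : ℝ} {a b J : ℕ}
    (ha : ⌈α * n⌉₊ ≤ a) (hm : ⌈α * n⌉₊ < n) (hJ : J ≤ n - ⌈α * n⌉₊) {s t Λ : ℝ}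
    (hA : (window n a b).card * (J : ℝ) * (Real.exp s - 1) ≤
      (s * t - Λ) * (n - ⌈α * n⌉₊ : ℕ)) :
    ({σ : Fin n ≃ X | s * t ≤ s * (((((List.ofFn σ).drop a).take b).toFinset ∩
        far J (unread α σ) (refClustering A δ k n α (List.ofFn σ))).card : ℝ)}.ncard : ℝ) ≤
      Real.exp (-Λ) * Nat.card (Fin n ≃ X) := by
  set E : Set (Fin n ≃ X) := {σ : Fin n ≃ X | s * t ≤ s *
    (((((List.ofFn σ).drop a).take b).toFinset ∩
        far J (unread α σ) (refClustering A δ k n α (List.ofFn σ))).card : ℝ)} with hE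
  have hinv : ∀ (σ : Fin n ≃ X) (π : Equiv.Perm (unread α σ)),
      phase1 n α (List.ofFn (σ.trans (Equiv.Perm.ofSubtype π))) = phase1 n α (List.ofFn σ) :=
    fun σ π => phase1_trans_of_disjoint σ (fun x hx => by simpa [unread] using hx) π
  have hVinv : ∀ (σ : Fin n ≃ X) (π : Equiv.Perm (unread α σ)),
      unread α (σ.trans (Equiv.Perm.ofSubtype π)) = unread α σ := fun σ π => by
    rw [unread, hinv, unread]
  have h := ncard_inter_le_of_perm (fun σ : Fin n ≃ X => unread α σ) Set.univ E
    (ε := Real.exp (-Λ)) hVinv (fun _ _ _ => Set.mem_univ _) fun σ _ => ?_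
  · rwa [Set.univ_inter, Set.ncard_univ] at h
  · set T := refClustering A δ k n α (List.ofFn σ) with hT
    set Q := (((List.ofFn σ).drop a).take b).toFinset with hQ
    have hQV : Q ⊆ unread α σ := fun x hx => by
      have := not_mem_phase1 ha (List.mem_toFinset.1 hx)
      simpa [unread] using this
    have hQcard : Q.card = (window n a b).card := by
      rw [hQ, toFinset_drop_take, Finset.card_map]
    have hVcard := card_unread σ hm.le
    have hfar : (far J (unread α σ) T).card = J := by
      rw [card_far, hVcard]
      exact min_eq_left hJ
    have hVne : (unread α σ).Nonempty := by
      rw [← Finset.card_pos, hVcard]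
      omega
    have h1 := chernoff_perm hVne hQV (far_subset J (unread α σ) T) (s := s) (t := t)
      (A := s * t - Λ) (by rw [hQcard, hfar, hVcard]; exact hA)
    rw [show s * t - Λ - s * t = -Λ by ring] at h1
    refine le_trans (le_of_eq ?_) h1
    congr 2
    ext π
    simp only [hE, Set.mem_ofPred_eq, hVinv, refClustering_congr (hinv σ π), ← hT]
    have hcount : (((((List.ofFn (σ.trans (Equiv.Perm.ofSubtype π))).drop a).take b).toFinset ∩
        far J (unread α σ) T).card : ℝ) =
        ((Q.filter fun x => Equiv.Perm.ofSubtype π x ∈ far J (unread α σ) T).card : ℝ) := by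
      rw [ofFn_trans, ← List.map_drop, ← List.map_take, toFinset_map]
      have : Finset.image (Equiv.Perm.ofSubtype π) Q ∩ far J (unread α σ) T =
          (Q.filter fun x => Equiv.Perm.ofSubtype π x ∈ far J (unread α σ) T).image
            (Equiv.Perm.ofSubtype π) := by
        ext y
        simp only [Finset.mem_inter, Finset.mem_image, Finset.mem_filter]
        constructor
        · rintro ⟨⟨x, hx, rfl⟩, h2⟩
          exact ⟨x, ⟨hx, h2⟩, rfl⟩
        · rintro ⟨x, ⟨hx, h2⟩, rfl⟩
          exact ⟨⟨x, hx, rfl⟩, h2⟩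
      rw [this, Finset.card_image_of_injective _ (Equiv.injective _)]
    rw [hcount]

/-- The event that the first `M` points of the cell of `c` in the third phase all lie beyond the
radius of the cell, although the cell has at least `M` points and few points outside `L`. -/
def firstOuter (A : Finset X → ℕ → Finset X) (δ : ℝ) (k : ℕ) (n : ℕ) (α γ : ℝ) (M : ℕ)
    (L : Finset X) (c : X) : Set (Fin n ≃ X) :=
  {σ | 4 * (cell (phase3 n α γ (List.ofFn σ)).toFinset
        (refClustering A δ k n α (List.ofFn σ)) c \ L).card ≤
      (cell (phase3 n α γ (List.ofFn σ)).toFinset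
        (refClustering A δ k n α (List.ofFn σ)) c).card ∧
    M ≤ (cell (phase3 n α γ (List.ofFn σ)).toFinset
        (refClustering A δ k n α (List.ofFn σ)) c).card ∧
    ∀ y ∈ ((phase3 n α γ (List.ofFn σ)).filter fun x =>
        nearest (refClustering A δ k n α (List.ofFn σ)) x = c).take M,
      y ∈ cellOuter (phase3 n α γ (List.ofFn σ)).toFinset
        (refClustering A δ k n α (List.ofFn σ)) L c}

theorem seven_twentieths_le_exp : (7 / 20 : ℝ) ≤ Real.exp (-1) := by
  have h1 := Real.exp_one_lt_d9
  rw [Real.exp_neg]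
  refine le_trans ?_ (inv_anti₀ (Real.exp_pos 1) h1.le)
  norm_num

/-- Conditionally on `c` being a reference center, the order in which the points of its cell arrive
is uniformly random. -/
theorem ncard_firstOuter_le (A : Finset X → ℕ → Finset X) (δ : ℝ) (k : ℕ) (n : ℕ) (α γ : ℝ)
    (M : ℕ) (L : Finset X) (c : X) :
    (({σ : Fin n ≃ X | c ∈ refClustering A δ k n α (List.ofFn σ)} ∩
        firstOuter A δ k n α γ M L c).ncard : ℝ) ≤
      Real.exp (-M) * ({σ : Fin n ≃ X | c ∈ refClustering A δ k n α (List.ofFn σ)}.ncard : ℝ) := by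
  set T : (Fin n ≃ X) → Finset X := fun σ => refClustering A δ k n α (List.ofFn σ) with hT
  set V : (Fin n ≃ X) → Finset X := fun σ => cell (phase3 n α γ (List.ofFn σ)).toFinset (T σ) c
    with hV
  have hVP : ∀ σ, V σ ⊆ (phase3 n α γ (List.ofFn σ)).toFinset := fun σ => Finset.filter_subset _ _
  have hinv : ∀ (σ : Fin n ≃ X) (π : Equiv.Perm (V σ)),
      phase1 n α (List.ofFn (σ.trans (Equiv.Perm.ofSubtype π))) = phase1 n α (List.ofFn σ) :=
    fun σ π => phase1_trans_of_disjoint σ (fun x hx =>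
      not_mem_phase1 (by omega) (List.mem_toFinset.1 (hVP σ hx))) π
  have hTinv : ∀ (σ : Fin n ≃ X) (π : Equiv.Perm (V σ)),
      T (σ.trans (Equiv.Perm.ofSubtype π)) = T σ := fun σ π => refClustering_congr (hinv σ π)
  have hPinv : ∀ (σ : Fin n ≃ X) (π : Equiv.Perm (V σ)),
      (phase3 n α γ (List.ofFn (σ.trans (Equiv.Perm.ofSubtype π)))).toFinset =
        (phase3 n α γ (List.ofFn σ)).toFinset := fun σ π => by
    rw [ofFn_trans, phase3_map, toFinset_map]
    exact image_ofSubtype_of_subset (hVP σ) π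
  have hVinv : ∀ (σ : Fin n ≃ X) (π : Equiv.Perm (V σ)),
      V (σ.trans (Equiv.Perm.ofSubtype π)) = V σ := fun σ π => by
    simp only [hV, hTinv, hPinv]
  refine ncard_inter_le_of_perm V _ _ hVinv (fun σ hσ π => ?_) fun σ _ => ?_
  · have h1 : c ∈ T σ := hσ
    have h2 : c ∈ T (σ.trans (Equiv.Perm.ofSubtype π)) := by rw [hTinv]; exact h1
    exact h2
  · set P := (phase3 n α γ (List.ofFn σ)) with hP
    set B := cellOuter P.toFinset (T σ) L c with hB
    by_cases hgood : 4 * (V σ \ L).card ≤ (V σ).card ∧ M ≤ (V σ).card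
    · obtain ⟨hg, hM⟩ := hgood
      set l := P.filter fun x => nearest (T σ) x = c with hl
      have hPnd : P.Nodup := (nodup_ofFn σ).sublist
        ((List.take_sublist _ _).trans (List.drop_sublist _ _))
      have hlV : l.toFinset = V σ := by
        rw [hl, List.toFinset_filter]
        simp [hV, cell, hP]
      have hlen : l.length = (V σ).card := by
        rw [← hlV, List.toFinset_card_of_nodup (hPnd.filter _)]
      have hQV : (l.take M).toFinset ⊆ V σ := fun x hx => by
        rw [← hlV]
        exact List.mem_toFinset.2 (List.mem_of_mem_take (List.mem_toFinset.1 hx))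
      have hQcard : (l.take M).toFinset.card = M := by
        rw [List.toFinset_card_of_nodup ((hPnd.filter _).sublist (List.take_sublist _ _)),
          List.length_take, hlen]
        exact min_eq_left hM
      have h1 := ncard_perm_forall_mem_le hQV (Finset.filter_subset _ _ : B ⊆ V σ)
        (ρ := 7 / 20) (card_cellOuter_le hg)
      rw [hQcard] at h1
      have h2 : (7 / 20 : ℝ) ^ M ≤ Real.exp (-M) := by
        refine (pow_le_pow_left₀ (by norm_num) seven_twentieths_le_exp M).trans (le_of_eq ?_)
        rw [← Real.exp_nat_mul]
        ring_nf
      refine le_trans ?_ (h1.trans (mul_le_mul_of_nonneg_right h2 (by positivity)))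
      refine mod_cast Set.ncard_le_ncard (fun π hπ x hx => ?_) (Set.toFinite _)
      obtain ⟨-, -, h3⟩ := hπ
      have e1 : refClustering A δ k n α (List.ofFn (σ.trans (Equiv.Perm.ofSubtype π))) = T σ :=
        hTinv σ π
      rw [e1, hPinv] at h3
      refine h3 _ ?_
      rw [ofFn_trans, phase3_map, List.filter_map, ← List.map_take]
      refine List.mem_map_of_mem ?_
      have e2 : (P.filter ((fun x => decide (nearest (T σ) x = c)) ∘ Equiv.Perm.ofSubtype π)) = l := by
        rw [hl]
        refine List.filter_congr fun y hy => ?_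
        have h4 := ofSubtype_mem_iff (subset_refl (V σ)) π y
        have h5 := ofSubtype_mem_iff (hVP σ) π y
        have h6 : ∀ z ∈ P, (z ∈ V σ ↔ nearest (T σ) z = c) := fun z hz => by
          simp [hV, cell, ← hP, hz]
        have h7 : Equiv.Perm.ofSubtype π y ∈ P :=
          List.mem_toFinset.1 (h5.2 (List.mem_toFinset.2 hy))
        rw [h6 _ hy, h6 _ h7] at h4
        simp [h4]
      rw [← hP, e2]
      exact List.mem_toFinset.1 hx
    · have : {π : Equiv.Perm (V σ) | σ.trans (Equiv.Perm.ofSubtype π) ∈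
          firstOuter A δ k n α γ M L c} = ∅ := by
        rw [Set.eq_empty_iff_forall_notMem]
        rintro π ⟨h1, h2, -⟩
        have e := hVinv σ π
        simp only [hV, hT] at e
        rw [e] at h1 h2
        exact hgood ⟨h1, h2⟩
      rw [this]
      simp only [Set.ncard_empty, Nat.cast_zero]
      positivity

/-- The union bound over the centers of the reference clustering. -/
theorem ncard_exists_firstOuter_le (A : Finset X → ℕ → Finset X) (δ : ℝ) (k : ℕ) (n : ℕ)
    (α γ : ℝ) (M : ℕ) (L : Finset X) {K : ℝ}
    (hK : ∀ σ : Fin n ≃ X, ((refClustering A δ k n α (List.ofFn σ)).card : ℝ) ≤ K) :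
    ({σ : Fin n ≃ X | ∃ c ∈ refClustering A δ k n α (List.ofFn σ),
        σ ∈ firstOuter A δ k n α γ M L c}.ncard : ℝ) ≤
      K * Real.exp (-M) * Nat.card (Fin n ≃ X) := by
  classical
  set D : X → Set (Fin n ≃ X) := fun c => {σ | c ∈ refClustering A δ k n α (List.ofFn σ)} with hD
  have hsub : {σ : Fin n ≃ X | ∃ c ∈ refClustering A δ k n α (List.ofFn σ),
      σ ∈ firstOuter A δ k n α γ M L c} ⊆
      ⋃ c ∈ (Finset.univ : Finset X), D c ∩ firstOuter A δ k n α γ M L c := by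
    rintro σ ⟨c, hc, hσ⟩
    simp only [Set.mem_iUnion]
    exact ⟨c, Finset.mem_univ c, hc, hσ⟩
  have h1 : ({σ : Fin n ≃ X | ∃ c ∈ refClustering A δ k n α (List.ofFn σ),
      σ ∈ firstOuter A δ k n α γ M L c}.ncard : ℝ) ≤
      ∑ c : X, ((D c ∩ firstOuter A δ k n α γ M L c).ncard : ℝ) := by
    exact_mod_cast (Set.ncard_le_ncard hsub (Set.toFinite _)).trans
      (Finset.set_ncard_biUnion_le _ _)
  have h2 : ∑ c : X, ((D c).ncard : ℝ) ≤ K * Nat.card (Fin n ≃ X) := by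
    simp only [ncard_eq_sum_ite]
    rw [Finset.sum_comm]
    calc _ ≤ ∑ _σ : Fin n ≃ X, K := Finset.sum_le_sum fun σ _ => by
            simpa [hD] using hK σ
      _ = K * Nat.card (Fin n ≃ X) := by
            rw [Finset.sum_const, Finset.card_univ, nsmul_eq_mul, Nat.card_eq_fintype_card,
              mul_comm]
  calc _ ≤ _ := h1
    _ ≤ ∑ c : X, Real.exp (-M) * ((D c).ncard : ℝ) :=
        Finset.sum_le_sum fun c _ => ncard_firstOuter_le A δ k n α γ M L c
    _ = Real.exp (-M) * ∑ c : X, ((D c).ncard : ℝ) := by rw [Finset.mul_sum]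
    _ ≤ Real.exp (-M) * (K * Nat.card (Fin n ≃ X)) :=
        mul_le_mul_of_nonneg_left h2 (Real.exp_pos _).le
    _ = _ := by ring

end Conditional

/-! ### The first two samples of a random stream -/

theorem ncard_le_add {Ω : Type*} [Finite Ω] {S A B : Set Ω} {a b N : ℝ} (h : S ⊆ A ∪ B)
    (hA : (A.ncard : ℝ) ≤ a * N) (hB : (B.ncard : ℝ) ≤ b * N) : (S.ncard : ℝ) ≤ (a + b) * N := by
  have h1 : (S.ncard : ℝ) ≤ A.ncard + B.ncard := by
    exact_mod_cast (Set.ncard_le_ncard h (Set.toFinite _)).trans (Set.ncard_union_le A B)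
  linarith

theorem ncard_exists_le {Ω X : Type*} [Finite Ω] (O : Finset X) (E : X → Set Ω) {ε : ℝ}
    (h : ∀ c ∈ O, ((E c).ncard : ℝ) ≤ ε) :
    ({σ | ∃ c ∈ O, σ ∈ E c}.ncard : ℝ) ≤ O.card * ε := by
  have h1 : ({σ | ∃ c ∈ O, σ ∈ E c}.ncard : ℝ) ≤ ∑ c ∈ O, ((E c).ncard : ℝ) := by
    have hsub : {σ | ∃ c ∈ O, σ ∈ E c} ⊆ ⋃ c ∈ O, E c := by
      rintro σ ⟨c, hc, hσ⟩
      simp only [Set.mem_iUnion]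
      exact ⟨c, hc, hσ⟩
    exact_mod_cast (Set.ncard_le_ncard hsub (Set.toFinite _)).trans
      (Finset.set_ncard_biUnion_le _ _)
  refine h1.trans ((Finset.sum_le_card_nsmul _ _ _ h).trans (le_of_eq (nsmul_eq_mul _ _)))

theorem infDist_le_risk_univ {X : Type*} [Fintype X] [MetricSpace X] (OPT : Finset X) (x : X) :
    Metric.infDist x (OPT : Set X) ≤ risk Finset.univ OPT :=
  Finset.single_le_sum (f := fun x => Metric.infDist x (OPT : Set X))
    (fun _ _ => Metric.infDist_nonneg) (Finset.mem_univ x)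

section Heavy

variable {X : Type*} [Fintype X] [MetricSpace X]

/-- The points whose cost for `OPT` is large: all others cost at most `α R / (20 L)`, where `R` is
the optimal risk and `L` the logarithmic term. -/
noncomputable def heavy (k : ℕ) (δ α : ℝ) (OPT : Finset X) : Finset X :=
  Finset.univ.filter fun x =>
    α * risk Finset.univ OPT / (20 * logTerm k δ) < Metric.infDist x (OPT : Set X)

theorem card_heavy_le {k : ℕ} {δ α : ℝ} {OPT : Finset X} (hL : 0 < logTerm k δ) :
    α * ((heavy k δ α OPT).card : ℝ) ≤ 20 * logTerm k δ := by
  set R := risk Finset.univ OPT with hR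
  rcases (risk_nonneg Finset.univ OPT).eq_or_lt with h0 | h0
  · have : heavy k δ α OPT = ∅ := by
      refine Finset.filter_eq_empty_iff.2 fun x _ => ?_
      rw [← h0]
      have := infDist_le_risk_univ OPT x
      rw [← h0] at this
      simpa using this
    rw [this]
    simp only [Finset.card_empty, Nat.cast_zero, mul_zero]
    positivity
  · have h1 : ((heavy k δ α OPT).card : ℝ) * (α * R / (20 * logTerm k δ)) ≤ R := by
      rw [← nsmul_eq_mul]
      refine (Finset.card_nsmul_le_sum _ _ _ fun x hx => (Finset.mem_filter.1 hx).2.le).trans ?_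
      exact risk_mono (Finset.subset_univ _) OPT
    rw [← mul_div_assoc, div_le_iff₀ (by positivity)] at h1
    refine le_of_mul_le_mul_right ?_ h0
    linarith

end Heavy

section Events

variable {X : Type*} [Fintype X] [MetricSpace X] [LinearOrder X]

variable {k n : ℕ} {δ α : ℝ} {OPT : Finset X}

/-- The numerical condition of the upper tail bound for a window with about `α n` positions. -/
theorem upper_tail_cond {W B b Λ t N : ℝ} (hN : 0 ≤ N) (hα : 0 ≤ α) (hW0 : 0 ≤ W)
    (hW : W ≤ 101 / 100 * α * N) (hB : B ≤ b) (hb : 0 ≤ b)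
    (h : 1736 / 1000 * (α * b) ≤ t - Λ) : W * B * (Real.exp 1 - 1) ≤ (t - Λ) * N := by
  have he := Real.exp_one_lt_d9
  have he' := Real.add_one_le_exp (1 : ℝ)
  calc W * B * (Real.exp 1 - 1) ≤ (101 / 100 * α * N) * b * (17183 / 10000) := by
        refine mul_le_mul ?_ (by linarith) (by linarith) (by positivity)
        exact (mul_le_mul_of_nonneg_left hB hW0).trans (mul_le_mul_of_nonneg_right hW hb)
    _ ≤ 1736 / 1000 * (α * b) * N := by
        have : 0 ≤ α * b * N := by positivity
        linarith
    _ ≤ _ := mul_le_mul_of_nonneg_right h hN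

/-- Apart from the heavy points, a sample costs about as much as it should. -/
theorem ncard_risk_gt_le (hn : 0 < n) (hα : 0 < α) (hL : 4 ≤ logTerm k δ) {a b : ℕ}
    (hW : ((window n a b).card : ℝ) ≤ 101 / 100 * α * n) :
    ({σ : Fin n ≃ X | 2 * α * risk Finset.univ OPT <
      risk ((((List.ofFn σ).drop a).take b).toFinset \ heavy k δ α OPT) OPT}.ncard : ℝ) ≤
      Real.exp (-logTerm k δ) * Nat.card (Fin n ≃ X) := by
  set R := risk Finset.univ OPT with hR
  set L := logTerm k δ with hLdef
  have hL0 : 0 < L := by linarith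
  rcases (risk_nonneg Finset.univ OPT).eq_or_lt with h0 | h0
  · have : {σ : Fin n ≃ X | 2 * α * R <
        risk ((((List.ofFn σ).drop a).take b).toFinset \ heavy k δ α OPT) OPT} = ∅ := by
      rw [Set.eq_empty_iff_forall_notMem]
      intro σ hσ
      have h1 : 2 * α * R < _ := hσ
      have h2 : risk ((((List.ofFn σ).drop a).take b).toFinset \ heavy k δ α OPT) OPT ≤ R :=
        risk_mono (Finset.subset_univ _) OPT
      rw [hR, ← h0] at h1 h2
      linarith
    rw [this]
    simp only [Set.ncard_empty, Nat.cast_zero]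
    positivity
  rw [← hR] at h0
  set lam := α * R / (20 * L) with hlam
  have hlam0 : 0 < lam := by positivity
  set w : X → ℝ := fun x => if x ∈ heavy k δ α OPT then 0 else Metric.infDist x (OPT : Set X) / lam
    with hw
  have hw0 : ∀ x, 0 ≤ w x := fun x => by
    simp only [hw]
    split_ifs
    · exact le_rfl
    · exact div_nonneg Metric.infDist_nonneg hlam0.le
  have hw1 : ∀ x, w x ≤ 1 := fun x => by
    simp only [hw]
    split_ifs with h
    · exact zero_le_one
    · rw [div_le_one hlam0]
      simpa [heavy] using h
  have hsum : ∀ P : Finset X, risk (P \ heavy k δ α OPT) OPT = lam * ∑ x ∈ P, w x := by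
    intro P
    rw [Finset.mul_sum, ← Finset.sum_inter_add_sum_sdiff P (heavy k δ α OPT)]
    rw [Finset.sum_eq_zero (s := P ∩ heavy k δ α OPT) fun x hx => by
      simp [hw, (Finset.mem_inter.1 hx).2], zero_add, risk]
    refine Finset.sum_congr rfl fun x hx => ?_
    simp only [hw, (Finset.mem_sdiff.1 hx).2, if_false]
    field_simp
  have hW1 : α * ∑ x, w x ≤ 20 * L := by
    have h1 : lam * ∑ x, w x ≤ R := by
      rw [← hsum]
      exact risk_mono (Finset.subset_univ _) OPT
    rw [hlam, div_mul_eq_mul_div, div_le_iff₀ (by positivity)] at h1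
    refine le_of_mul_le_mul_right ?_ h0
    linarith
  have h := upper_tail hn hw0 hw1 a b (t := 40 * L) (Λ := L)
    (upper_tail_cond (by positivity) hα.le (by positivity) hW le_rfl
      (Finset.sum_nonneg fun x _ => hw0 x) (by linarith))
  refine le_trans (le_of_eq ?_) h
  congr 2
  ext σ
  simp only [Set.mem_ofPred_eq, hsum]
  have : 2 * α * R = lam * (40 * L) := by
    rw [hlam]
    field_simp
    ring
  rw [this]
  exact mul_lt_mul_iff_right₀ hlam0

/-- With high probability the first two samples represent the optimal clustering. -/
theorem ncard_not_goodSamples_le (hα : 0 < α) (hL : 4 ≤ logTerm k δ) (hk : 1 ≤ k)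
    (hOPT : OPT.Nonempty) (hcard : OPT.card ≤ k) (hn : 0 < n) (hm : 2 * ⌈α * n⌉₊ ≤ n)
    (hm' : (⌈α * n⌉₊ : ℝ) ≤ 101 / 100 * α * n) :
    ({σ : Fin n ≃ X | ¬ GoodSamples k δ α OPT (heavy k δ α OPT)
      (phase1 n α (List.ofFn σ)).toFinset (phase2 n α (List.ofFn σ)).toFinset}.ncard : ℝ) ≤
      (5 + 2 * k) * Real.exp (-logTerm k δ) * Nat.card (Fin n ≃ X) := by
  set L := logTerm k δ with hLdef
  set m := ⌈α * n⌉₊ with hmdef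
  set N : ℝ := (Nat.card (Fin n ≃ X) : ℝ) with hN
  set F := heavy k δ α OPT with hF
  set O := largeCenters k δ α OPT with hO
  set S := clusterUnion OPT O with hS
  have hn0 : (0 : ℝ) < n := by exact_mod_cast hn
  have hL0 : 0 < L := by linarith
  have hk0 : (1 : ℝ) ≤ k := by exact_mod_cast hk
  have hφ := mul_phi (k := k) (δ := δ) hα
  rw [← hLdef] at hφ
  have hφ0 : 0 ≤ phi k δ α := by
    have : 0 ≤ α * phi k δ α := by rw [hφ]; positivity
    exact nonneg_of_mul_nonneg_right this hα
  have hmα : α * n ≤ m := Nat.le_ceil _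
  have hw1 : (window n 0 m).card = m := by rw [card_window]; omega
  have hw2 : (window n m m).card = m := by rw [card_window]; omega
  have hw1' : ((window n 0 m).card : ℝ) ≤ 101 / 100 * α * n := by rw [hw1]; exact hm'
  have hw2' : ((window n m m).card : ℝ) ≤ 101 / 100 * α * n := by rw [hw2]; exact hm'
  have hF1 := card_heavy_le (k := k) (δ := δ) (α := α) (OPT := OPT) hL0
  rw [← hF, ← hLdef] at hF1
  have hlarge : ∀ c ∈ O, 150 * L ≤ α * ((cluster OPT c).card : ℝ) := fun c hc => by
    rw [← hφ]
    exact mul_le_mul_of_nonneg_left (mem_largeCenters.1 hc).2 hα.le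
  have hOk : (O.card : ℝ) ≤ k := by
    exact_mod_cast (Finset.card_le_card fun c hc => (mem_largeCenters.1 hc).1).trans hcard
  have h1 : ({σ : Fin n ≃ X | 38 * L < (((phase1 n α (List.ofFn σ)).toFinset ∩ F).card : ℝ)}.ncard
      : ℝ) ≤ Real.exp (-L) * N := by
    have h := upper_tail_card hn F 0 m (t := 38 * L) (Λ := L)
      (upper_tail_cond hn0.le hα.le (by positivity) hw1' le_rfl (by positivity) (by linarith))
    simp only [List.drop_zero] at h
    exact h
  have h2 : ({σ : Fin n ≃ X | 2 * α * risk Finset.univ OPT <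
      risk ((phase1 n α (List.ofFn σ)).toFinset \ F) OPT}.ncard : ℝ) ≤ Real.exp (-L) * N := by
    have h := ncard_risk_gt_le (OPT := OPT) hn hα hL hw1'
    simp only [List.drop_zero] at h
    exact h
  have h3 : ({σ : Fin n ≃ X | 300 * L < (((phase2 n α (List.ofFn σ)).toFinset ∩ F).card : ℝ)}.ncard
      : ℝ) ≤ Real.exp (-L) * N :=
    upper_tail_card hn F m m (t := 300 * L) (Λ := L)
      (upper_tail_cond hn0.le hα.le (by positivity) hw2' le_rfl (by positivity) (by linarith))
  have h4 : ({σ : Fin n ≃ X | 2 * α * risk Finset.univ OPT <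
      risk ((phase2 n α (List.ofFn σ)).toFinset \ F) OPT}.ncard : ℝ) ≤ Real.exp (-L) * N :=
    ncard_risk_gt_le (OPT := OPT) hn hα hL hw2'
  have h5 : ({σ : Fin n ≃ X | 2 * α * (k * phi k δ α) <
      (((phase2 n α (List.ofFn σ)).toFinset \ S).card : ℝ)}.ncard : ℝ) ≤ Real.exp (-L) * N := by
    simp only [Finset.sdiff_eq_inter_compl]
    refine upper_tail_card hn Sᶜ m m (Λ := L)
      (upper_tail_cond (b := k * phi k δ α) hn0.le hα.le (by positivity) hw2'
        (card_compl_largePoints_le hOPT hcard hφ0) (by positivity) ?_)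
    have e : α * (k * phi k δ α) = k * (150 * L) := by rw [← hφ]; ring
    rw [mul_assoc, e]
    nlinarith
  have h6 : ({σ : Fin n ≃ X | ∃ c ∈ O, σ ∈ {σ : Fin n ≃ X |
      (((phase1 n α (List.ofFn σ)).toFinset ∩ cluster OPT c).card : ℝ) <
        4 / 5 * α * (cluster OPT c).card}}.ncard : ℝ) ≤ O.card * (Real.exp (-L) * N) := by
    refine ncard_exists_le O _ fun c hc => ?_
    have h := lower_tail_card hn (cluster OPT c) 0 m (t := 4 / 5 * α * (cluster OPT c).card)
      (Λ := L) (by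
        have e := hlarge c hc
        rw [hw1]
        have e2 : α * n * ((cluster OPT c).card : ℝ) ≤ m * ((cluster OPT c).card : ℝ) :=
          mul_le_mul_of_nonneg_right hmα (by positivity)
        have e3 := mul_le_mul_of_nonneg_right e hn0.le
        linarith [mul_pos hL0 hn0])
    simp only [List.drop_zero] at h
    exact h
  have h7 : ({σ : Fin n ≃ X | ∃ c ∈ O, σ ∈ {σ : Fin n ≃ X | 2 * α * (cluster OPT c).card <
      (((phase2 n α (List.ofFn σ)).toFinset ∩ cluster OPT c).card : ℝ)}}.ncard : ℝ) ≤
      O.card * (Real.exp (-L) * N) := by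
    refine ncard_exists_le O _ fun c hc => ?_
    refine upper_tail_card hn (cluster OPT c) m m (Λ := L)
      (upper_tail_cond hn0.le hα.le (by positivity) hw2' le_rfl (by positivity) ?_)
    have e := hlarge c hc
    linarith
  rw [← mul_assoc] at h6 h7
  have h67 := ncard_le_add subset_rfl h6 h7
  have h567 := ncard_le_add subset_rfl h5 h67
  have h4567 := ncard_le_add subset_rfl h4 h567
  have h34567 := ncard_le_add subset_rfl h3 h4567
  have h24567 := ncard_le_add subset_rfl h2 h34567
  refine (ncard_le_add (fun σ hσ => ?_) h1 h24567).trans ?_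
  · by_contra hcon
    simp only [Set.mem_union, Set.mem_ofPred_eq, not_or, not_lt, not_exists, not_and] at hcon
    obtain ⟨c1, c2, c3, c4, c5, c6, c7⟩ := hcon
    exact hσ ⟨c1, c2, c3, c4, c5, c6, c7⟩
  · refine mul_le_mul_of_nonneg_right ?_ (by positivity)
    have := mul_le_mul_of_nonneg_right hOk (Real.exp_pos (-L)).le
    linarith

end Events

/-! ### Output of the procedure on a good stream -/

section Size

/-- The size bound, with all constants made explicit. -/
theorem size_bound {k ℓ L α γ τ M r J K U : ℝ} (hk : 2 ≤ k) (hℓ : 1 / 2 ≤ ℓ) (hL : L ≤ 6 * ℓ)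
    (hα : 0 < α) (hαγ : α < γ) (hγ : γ ≤ 1) (hτ : 0 < τ) (hM : 0 ≤ M)
    (hr : r ≤ 300 * (k + 1) * L + 1) (hJ : J ≤ 2 * (r + 3 * α * k * τ) / α + 1)
    (hK : K ≤ k + 38 * L) (hU : U ≤ 3 * γ * J + K * (M + 1)) :
    U ≤ 40000 * (γ / α * k * ℓ + k * τ + (k + ℓ) * M) := by
  have hγ0 : 0 < γ := hα.trans hαγ
  set g := γ / α with hg
  have hg1 : 1 ≤ g := (one_le_div hα).2 hαγ.le
  have hkℓ : 1 ≤ k * ℓ := by nlinarith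
  have hgkℓ : k * ℓ ≤ g * (k * ℓ) := le_mul_of_one_le_left (by linarith) hg1
  have hk' : k ≤ 2 * (k * ℓ) := by nlinarith
  have hℓ' : ℓ ≤ k * ℓ / 2 := by nlinarith
  have hr' : r ≤ 2701 * (k * ℓ) := by
    have h1 : (k + 1) * L ≤ (k + 1) * (6 * ℓ) := mul_le_mul_of_nonneg_left hL (by linarith)
    linarith
  have hJ' : γ * J ≤ 2 * (g * r) + 6 * (k * τ) + 1 := by
    have h1 := mul_le_mul_of_nonneg_left hJ hγ0.le
    have h2 : γ * (2 * (r + 3 * α * k * τ) / α + 1) = 2 * (g * r) + γ * (6 * (k * τ)) + γ := by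
      rw [hg]
      field_simp
      ring
    have h3 : γ * (6 * (k * τ)) ≤ 1 * (6 * (k * τ)) :=
      mul_le_mul_of_nonneg_right hγ (by positivity)
    linarith
  have h1 : g * r ≤ 2701 * (g * (k * ℓ)) := by
    have := mul_le_mul_of_nonneg_left hr' (by linarith : 0 ≤ g)
    linarith
  have h2 : K * (M + 1) ≤ (k + 228 * ℓ) * (M + 1) :=
    mul_le_mul_of_nonneg_right (by linarith) (by linarith)
  have h3 : 0 ≤ k * M := by positivity
  have h4 : 0 ≤ ℓ * M := by positivity
  have h5 : 0 ≤ k * τ := by positivity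
  have e : g * k * ℓ = g * (k * ℓ) := by ring
  rw [e]
  linarith

end Size

theorem card_refClustering_le {k : ℕ} {δ : ℝ} (hk : 2 ≤ k) (hδ : 0 < δ) (hδ1 : δ < 1) {n : ℕ} {α : ℝ}
    {X : Type*} [LinearOrder X] {A : Finset X → ℕ → Finset X} (hA : IsOfflineAlgorithm A)
    (l : List X) : ((refClustering A δ k n α l).card : ℝ) ≤ kPlus k δ := by
  have hL := four_le_logTerm hk hδ hδ1
  have h := (hA (phase1 n α l).toFinset _ (two_le_floor_kPlus hk hδ hδ1)).2.1
  refine le_trans (b := ((⌊kPlus k δ⌋₊ : ℕ) : ℝ)) (by exact_mod_cast h) (Nat.floor_le ?_)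
  rw [kPlus_eq]
  positivity

section Procedure

variable {X : Type*} [MetricSpace X] [LinearOrder X]

variable {A : Finset X → ℕ → Finset X} {k n : ℕ} {δ α γ τ : ℝ} {M : ℕ}

theorem selectProc_eq (l : List X) :
    selectProc A δ k n α γ M τ l = (run (refClustering A δ k n α l)
      (riskEstimate A δ k n α l / (k * τ)) M (phase3 n α γ l)).selected := rfl

theorem riskEstimate_nonneg (hα : 0 < α) (l : List X) : 0 ≤ riskEstimate A δ k n α l :=
  mul_nonneg (by positivity) (risk_nonneg _ _)

/-- The number of far points in the second sample, by Markov's inequality. -/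
theorem card_far_phase2_le (hk : 2 ≤ k) (hα : 0 < α) (hτ : 0 < τ) (l : List X) :
    (((phase2 n α l).toFinset.filter fun x => riskEstimate A δ k n α l / (k * τ) <
      Metric.infDist x (refClustering A δ k n α l : Set X)).card : ℝ) ≤
      (⌈2 * α * (k + 1) * phi k δ α⌉₊ : ℝ) + 3 * α * k * τ := by
  have hk0 : (0 : ℝ) < k := by exact_mod_cast (by omega : 0 < k)
  have hψ0 := riskEstimate_nonneg (A := A) (δ := δ) (k := k) (n := n) hα l
  set ψ := riskEstimate A δ k n α l with hψ
  set T := refClustering A δ k n α l with hT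
  set r := ⌈2 * α * (k + 1) * phi k δ α⌉₊ with hr
  by_contra hlt
  push Not at hlt
  have h0 : 0 < 3 * α * k * τ := by positivity
  have hθ : 0 ≤ ψ / (k * τ) := by positivity
  have h1 := card_filter_mul_lt_truncRisk (r := r) (S := (phase2 n α l).toFinset) (T := T) hθ (by
    have h2 : (r : ℝ) < _ := (lt_add_of_pos_right _ h0).trans hlt
    exact_mod_cast h2)
  have h2 : truncRisk r (phase2 n α l).toFinset T = 3 * α * ψ := by
    rw [hψ, riskEstimate, ← hr, ← hT]
    field_simp
  have h3 : 3 * α * k * τ * (ψ / (k * τ)) = 3 * α * ψ := by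
    field_simp
  have h4 := mul_le_mul_of_nonneg_right (by linarith :
    3 * α * k * τ ≤ (((phase2 n α l).toFinset.filter fun x => ψ / (k * τ) <
      Metric.infDist x (T : Set X)).card : ℝ) - r) hθ
  linarith

end Procedure

section Conclusion

variable {X : Type*} [Fintype X] [MetricSpace X] [LinearOrder X]

/-- The three assertions about the output of the selection procedure on one stream. -/
def Conclusion (A : Finset X → ℕ → Finset X) (OPT : Finset X) (k n : ℕ) (δ α γ τ β : ℝ) (M : ℕ)
    (C : ℝ) (l : List X) : Prop :=
  ((selectProc A δ k n α γ M τ l).card : ℝ) ≤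
      C * (γ / α * k * Real.log (k / δ) + k * τ + (k + Real.log (k / δ)) * M) ∧
  (∀ c ∈ OPT, c ∈ phase3 n α γ l →
    (selectProc A δ k n α γ M τ l).Nonempty ∧
    risk (cluster OPT c) (selectProc A δ k n α γ M τ l) ≤
      risk (cluster OPT c) {c} +
        ((cluster OPT c).card : ℝ) / (k * τ) * (36 * β + 20) * risk Finset.univ OPT) ∧
  (γ = 1 - 2 * α → τ = phi k δ α → Real.log (8 * kPlus k δ / δ) ≤ M →
    ((largePoints k δ α OPT).Nonempty → (selectProc A δ k n α γ M τ l).Nonempty) ∧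
    risk (largePoints k δ α OPT) (selectProc A δ k n α γ M τ l) ≤
      risk (largePoints k δ α OPT) OPT + (468 * β + 260) * risk Finset.univ OPT)

variable {A : Finset X → ℕ → Finset X} {OPT : Finset X} {k n : ℕ} {δ α γ τ β : ℝ} {M : ℕ}

/-- The assertion about single clusters only needs the bound on the risk estimate. -/
theorem risk_cluster_selectProc_le (hk : 2 ≤ k) (hα : 0 < α) (hτ : 0 < τ) {l : List X}
    (hψ : riskEstimate A δ k n α l ≤ (18 * β + 10) * risk Finset.univ OPT) {c : X}
    (hc : c ∈ phase3 n α γ l) :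
    (selectProc A δ k n α γ M τ l).Nonempty ∧
    risk (cluster OPT c) (selectProc A δ k n α γ M τ l) ≤
      risk (cluster OPT c) {c} +
        ((cluster OPT c).card : ℝ) / (k * τ) * (36 * β + 20) * risk Finset.univ OPT := by
  have hk0 : (0 : ℝ) < k := by exact_mod_cast (by omega : 0 < k)
  have hψ0 := riskEstimate_nonneg (A := A) (δ := δ) (k := k) (n := n) hα l
  have h := risk_cluster_selected_le (T := refClustering A δ k n α l) (M := M)
    (by positivity : 0 ≤ riskEstimate A δ k n α l / (k * τ)) (phase3 n α γ l) (cluster OPT c) hc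
  rw [selectProc_eq]
  refine ⟨h.1, h.2.trans (add_le_add_right ?_ _)⟩
  calc ((cluster OPT c).card : ℝ) * (2 * (riskEstimate A δ k n α l / (k * τ)))
      = (cluster OPT c).card / (k * τ) * (2 * riskEstimate A δ k n α l) := by
        field_simp
    _ ≤ (cluster OPT c).card / (k * τ) * (2 * ((18 * β + 10) * risk Finset.univ OPT)) := by
        refine mul_le_mul_of_nonneg_left ?_ (by positivity)
        linarith
    _ = _ := by ring

/-- The assertions hold trivially when there are no large clusters because the whole space has
fewer than `φ` points: the second sample is then discarded entirely by the risk estimate. -/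
theorem conclusion_of_card_lt (hk : 2 ≤ k) (hδ : 0 < δ) (hδ1 : δ < 1) (hα : 0 < α)
    (hαγ : α < γ) (hγ : γ ≤ 1) (hτ : 0 < τ) (hβ : 1 ≤ β) (hn : Fintype.card X = n)
    (hnφ : (n : ℝ) < phi k δ α) (l : List X) :
    Conclusion A OPT k n δ α γ τ β M 40000 l := by
  have hk0 : (2 : ℝ) ≤ k := by exact_mod_cast hk
  have hL := four_le_logTerm hk hδ hδ1
  have hφ := mul_phi (k := k) (δ := δ) hα
  have hR := risk_nonneg Finset.univ OPT
  have hαn : α * n ≤ 150 * logTerm k δ := by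
    rw [← hφ]
    exact mul_le_mul_of_nonneg_left hnφ.le hα.le
  have hψ : riskEstimate A δ k n α l ≤ (18 * β + 10) * risk Finset.univ OPT := by
    have h1 : truncRisk ⌈2 * α * (k + 1) * phi k δ α⌉₊ (phase2 n α l).toFinset
        (refClustering A δ k n α l) ≤ 0 := by
      refine (truncRisk_le (E := (phase2 n α l).toFinset) ?_).trans (by simp [risk])
      rw [Finset.inter_self]
      refine (List.toFinset_card_le _).trans ((List.length_take_le _ _).trans
        (Nat.ceil_le_ceil ?_))
      have e : 2 * α * (k + 1) * phi k δ α = (k + 1) * (300 * logTerm k δ) := by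
        rw [show (300 : ℝ) * logTerm k δ = 2 * (150 * logTerm k δ) by ring, ← hφ]
        ring
      rw [e]
      nlinarith
    have h2 : riskEstimate A δ k n α l ≤ 0 := mul_nonpos_of_nonneg_of_nonpos (by positivity) h1
    exact h2.trans (by positivity)
  have hempty : largePoints k δ α OPT = ∅ := by
    rw [largePoints_eq]
    ext x
    simp only [mem_clusterUnion, mem_largeCenters, Finset.notMem_empty, iff_false, not_and, not_le]
    refine fun _ => lt_of_le_of_lt ?_ hnφ
    rw [← hn]
    exact_mod_cast Finset.card_le_univ _
  refine ⟨?_, fun c _ hc => risk_cluster_selectProc_le hk hα hτ hψ hc, fun _ _ _ => ?_⟩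
  · have h1 : (selectProc A δ k n α γ M τ l).card ≤ ⌈γ * n⌉₊ := by
      rw [selectProc_eq]
      exact (Finset.card_le_card (run_selected_subset _)).trans
        ((List.toFinset_card_le _).trans (List.length_take_le _ _))
    have hγ0 : 0 < γ := hα.trans hαγ
    have h2 : (⌈γ * n⌉₊ : ℝ) ≤ γ * n + 1 := (Nat.ceil_lt_add_one (by positivity)).le
    have h3 : ((selectProc A δ k n α γ M τ l).card : ℝ) ≤ (⌈γ * n⌉₊ : ℝ) := by exact_mod_cast h1
    have h4 : γ * n ≤ γ * phi k δ α := mul_le_mul_of_nonneg_left hnφ.le hγ0.le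
    have h5 : γ * phi k δ α = γ * (150 * logTerm k δ / α) := by rw [← hφ]; field_simp
    have hlog := logTerm_eq hk hδ
    have hlog2 := log_two_le_log_div hk hδ hδ1
    have hl2 := Real.log_two_gt_d9
    refine size_bound (L := logTerm k δ) (r := 25 * logTerm k δ) (K := 1) (J := 50 * logTerm k δ / α + 1) hk0
      (by linarith) (by linarith) hα hαγ hγ hτ (by positivity) (by nlinarith) ?_ ?_ ?_
    · have e : 2 * (25 * logTerm k δ + 3 * α * k * τ) / α + 1 =
          50 * logTerm k δ / α + 1 + 6 * (k * τ) := by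
        field_simp
        ring
      rw [e]
      exact le_add_of_nonneg_right (by positivity)
    · linarith
    · have e : 3 * γ * (50 * logTerm k δ / α + 1) = γ * (150 * logTerm k δ / α) + 3 * γ := by ring
      have hM : (0 : ℝ) ≤ M := by positivity
      rw [e]
      linarith
  · rw [hempty]
    simp only [Finset.not_nonempty_empty, false_implies, true_and]
    simp only [risk, Finset.sum_empty, zero_add]
    exact mul_nonneg (by positivity) hR

/-- The size of the output on a stream in which the `J` unread points that are furthest from the
reference clustering are neither underrepresented in the second sample nor overrepresented in the
third. -/
theorem card_selectProc_le (hk : 2 ≤ k) (hδ : 0 < δ) (hδ1 : δ < 1) (hα : 0 < α)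
    (hαγ : α < γ) (hγ : γ ≤ 1) (hτ : 0 < τ) (hA : IsOfflineAlgorithm A) {J : ℕ}
    {σ : Fin n ≃ X} (hm : ⌈α * n⌉₊ ≤ n)
    (hT : (refClustering A δ k n α (List.ofFn σ)).Nonempty)
    (hJ : (J : ℝ) ≤ 2 * ((⌈2 * α * (k + 1) * phi k δ α⌉₊ : ℝ) + 3 * α * k * τ) / α + 1)
    (h₂ : J ≤ n - ⌈α * n⌉₊ →
      (⌈2 * α * (k + 1) * phi k δ α⌉₊ : ℝ) + 3 * α * k * τ <
        (((phase2 n α (List.ofFn σ)).toFinset ∩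
          far J (unread α σ) (refClustering A δ k n α (List.ofFn σ))).card : ℝ))
    (h₃ : (((phase3 n α γ (List.ofFn σ)).toFinset ∩
      far J (unread α σ) (refClustering A δ k n α (List.ofFn σ))).card : ℝ) ≤ 3 * γ * J) :
    ((selectProc A δ k n α γ M τ (List.ofFn σ)).card : ℝ) ≤
      40000 * (γ / α * k * Real.log (k / δ) + k * τ + (k + Real.log (k / δ)) * M) := by
  set l := List.ofFn σ with hl
  set T := refClustering A δ k n α l with hTdef
  have hk0 : (2 : ℝ) ≤ k := by exact_mod_cast hk
  have hL := four_le_logTerm hk hδ hδ1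
  have hφ := mul_phi (k := k) (δ := δ) hα
  have hlog := logTerm_eq hk hδ
  have hlog2 := log_two_le_log_div hk hδ hδ1
  have hl2 := Real.log_two_gt_d9
  have hfar := card_far_points_le (Y := unread α σ) (T := T) (J := J)
    (θ := riskEstimate A δ k n α l / (k * τ)) (P₂ := (phase2 n α l).toFinset)
    (P₃ := (phase3 n α γ l).toFinset)
    (fun x hx => by
      have := not_mem_phase1 (α := α) (a := 2 * ⌈α * n⌉₊) (by omega) (List.mem_toFinset.1 hx)
      simpa [unread] using this)
    (card_far_phase2_le hk hα hτ l) (fun hJ' => h₂ (by rwa [card_unread σ hm] at hJ')) h₃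
  have hcard := card_selected_le (θ := riskEstimate A δ k n α l / (k * τ)) (M := M) hT
    (phase3 n α γ l)
  rw [← selectProc_eq] at hcard
  refine size_bound (L := logTerm k δ) (K := kPlus k δ) (J := J) hk0 (by linarith) (by linarith)
    hα hαγ hγ hτ (by positivity) ?_ hJ le_rfl ?_
  · have e : 2 * α * (k + 1) * phi k δ α = 300 * (k + 1) * logTerm k δ := by
      rw [show 300 * (k + 1) * logTerm k δ = 2 * (k + 1) * (150 * logTerm k δ) by ring, ← hφ]
      ring
    rw [e]
    exact (Nat.ceil_lt_add_one (by positivity)).le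
  · have h1 : ((selectProc A δ k n α γ M τ l).card : ℝ) ≤
        (((phase3 n α γ l).toFinset.filter fun x => riskEstimate A δ k n α l / (k * τ) <
          Metric.infDist x (T : Set X)).card : ℝ) + T.card * (M + 1) := by
      exact_mod_cast hcard
    have h2 := mul_le_mul_of_nonneg_right (card_refClustering_le (n := n) (α := α) hk hδ hδ1 hA l)
      (by positivity : (0 : ℝ) ≤ (M : ℝ) + 1)
    linarith

/-- The assertion about the large clusters, on a stream whose third phase represents them and in
which no reference cell starts with `M` points beyond its radius. -/
theorem risk_large_selectProc_le (hk : 2 ≤ k) (hδ : 0 < δ) (hδ1 : δ < 1) (hα : 0 < α)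
    (hβ : 1 ≤ β) (hOPT : OPT.Nonempty) (hcard : OPT.card ≤ k)
    {σ : Fin n ≃ X} (hT : (refClustering A δ k n α (List.ofFn σ)).Nonempty)
    (hψ : riskEstimate A δ k n α (List.ofFn σ) ≤ (18 * β + 10) * risk Finset.univ OPT)
    (hD : ∑ c ∈ largeCenters k δ α OPT, ((cluster OPT c).card : ℝ) *
      Metric.infDist c (refClustering A δ k n α (List.ofFn σ) : Set X) ≤
        (4 + 8 * β) * risk Finset.univ OPT)
    (hhalf : ∀ c ∈ largeCenters k δ α OPT, 1 / 2 * ((cluster OPT c).card : ℝ) ≤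
      (((phase3 n α γ (List.ofFn σ)).toFinset ∩ cluster OPT c).card : ℝ))
    (hfirst : ∀ c ∈ refClustering A δ k n α (List.ofFn σ),
      σ ∉ firstOuter A δ k n α γ M (clusterUnion OPT (largeCenters k δ α OPT)) c) :
    ((largePoints k δ α OPT).Nonempty →
      (selectProc A δ k n α γ M (phi k δ α) (List.ofFn σ)).Nonempty) ∧
    risk (largePoints k δ α OPT) (selectProc A δ k n α γ M (phi k δ α) (List.ofFn σ)) ≤
      risk (largePoints k δ α OPT) OPT + (468 * β + 260) * risk Finset.univ OPT := by
  set l := List.ofFn σ with hl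
  set T := refClustering A δ k n α l with hTdef
  set O := largeCenters k δ α OPT with hO
  set R := risk Finset.univ OPT with hR
  have hk0 : (0 : ℝ) < k := by exact_mod_cast (by omega : 0 < k)
  have hL := four_le_logTerm hk hδ hδ1
  have hφ := mul_phi (k := k) (δ := δ) hα
  have hφ0 : 0 < phi k δ α := by
    refine pos_of_mul_pos_right (a := α) ?_ hα.le
    rw [hφ]
    linarith
  have hψ0 := riskEstimate_nonneg (A := A) (δ := δ) (k := k) (n := n) hα l
  have hR0 : 0 ≤ R := risk_nonneg _ _
  have hnodup : (phase3 n α γ l).Nodup :=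
    (nodup_ofFn σ).sublist ((List.take_sublist _ _).trans (List.drop_sublist _ _))
  have hθ : 0 ≤ riskEstimate A δ k n α l / (k * phi k δ α) := by positivity
  rw [largePoints_eq, selectProc_eq, ← hO, ← hTdef]
  constructor
  · rintro ⟨x, hx⟩
    have hc := mem_clusterUnion.1 hx
    have h1 := hhalf _ hc
    have h2 := (mem_largeCenters.1 hc).2
    have h3 : 0 < ((phase3 n α γ l).toFinset ∩ cluster OPT (nearest OPT x)).card := by
      have : (0 : ℝ) < (((phase3 n α γ l).toFinset ∩ cluster OPT (nearest OPT x)).card : ℝ) := by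
        linarith
      exact_mod_cast this
    obtain ⟨y, hy⟩ := Finset.card_pos.1 h3
    exact (risk_cluster_selected_le hθ (phase3 n α γ l) ∅
      (List.mem_toFinset.1 (Finset.mem_inter.1 hy).1)).1
  · have hmass : riskEstimate A δ k n α l / (k * phi k δ α) *
        ((clusterUnion OPT O)ᶜ.card : ℝ) ≤ (18 * β + 10) * R := by
      have h1 := card_compl_largePoints_le hOPT hcard hφ0.le
      refine le_trans ?_ hψ
      rw [div_mul_eq_mul_div, div_le_iff₀ (by positivity)]
      exact mul_le_mul_of_nonneg_left h1 hψ0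
    have h := risk_large_selected_le (M := M) (R := R) hnodup hOPT hT hθ hhalf (fun c hc hg hM => by
      by_contra hcon
      push Not at hcon
      exact hfirst c hc ⟨hg, hM, hcon⟩) (risk_mono (Finset.subset_univ _) OPT) hD hmass
    have h1 : 0 ≤ β * R := by positivity
    linarith

end Conclusion

/-! ### Failure probability -/

section Probability

variable {X : Type*} [Fintype X] [MetricSpace X] [LinearOrder X]

variable {A : Finset X → ℕ → Finset X} {OPT : Finset X} {k n : ℕ} {δ α γ τ β : ℝ} {M : ℕ}

/-- The second sample contains its share of the `J` furthest unread points. -/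
theorem ncard_far_phase2_le (A : Finset X → ℕ → Finset X) {J : ℕ} {q Λ : ℝ} (hα : 0 < α)
    (hn : 0 < n) (hm : 2 * ⌈α * n⌉₊ ≤ n) (hJ : 2 * q ≤ α * J) (hΛ : 5 * Λ ≤ q) (hΛ0 : 0 ≤ Λ) :
    ({σ : Fin n ≃ X | J ≤ n - ⌈α * n⌉₊ ∧ (((phase2 n α (List.ofFn σ)).toFinset ∩
        far J (unread α σ) (refClustering A δ k n α (List.ofFn σ))).card : ℝ) ≤ q}.ncard : ℝ) ≤
      Real.exp (-Λ) * Nat.card (Fin n ≃ X) := by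
  have hn0 : (0 : ℝ) < n := by exact_mod_cast hn
  have hmα : α * n ≤ (⌈α * n⌉₊ : ℝ) := Nat.le_ceil _
  have hmpos : 0 < ⌈α * n⌉₊ := Nat.ceil_pos.2 (by positivity)
  set m := ⌈α * n⌉₊ with hmdef
  by_cases hJn : J ≤ n - m
  · have hw : (window n m m).card = m := by rw [card_window]; omega
    have h := chernoff_far (X := X) A δ k (n := n) (α := α) (a := m) (b := m) (J := J) (s := -1)
      (t := q) (Λ := Λ) le_rfl (by omega) hJn (by
        have he : Real.exp (-1) ≤ 2 / 5 := by
          rw [Real.exp_neg]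
          have h1 : (5 / 2 : ℝ) ≤ Real.exp 1 := by
            have := Real.quadratic_le_exp_of_nonneg (zero_le_one (α := ℝ))
            linarith
          exact (inv_anti₀ (by norm_num) h1).trans (by norm_num)
        have h1 : 2 * q * n ≤ m * (J : ℝ) := by
          calc 2 * q * n ≤ α * J * n := mul_le_mul_of_nonneg_right hJ hn0.le
            _ = (α * n) * J := by ring
            _ ≤ m * J := mul_le_mul_of_nonneg_right hmα (by positivity)
        have h2 : ((n - m : ℕ) : ℝ) ≤ n := by exact_mod_cast Nat.sub_le n m
        have h3 : (q + Λ) * ((n - m : ℕ) : ℝ) ≤ (q + Λ) * n :=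
          mul_le_mul_of_nonneg_left h2 (by linarith)
        have h4 : (q + Λ) * n ≤ 6 / 5 * q * n :=
          mul_le_mul_of_nonneg_right (by linarith) hn0.le
        have h5 : (m * (J : ℝ)) * (Real.exp (-1) - 1) ≤ (m * (J : ℝ)) * (-(3 / 5)) :=
          mul_le_mul_of_nonneg_left (by linarith) (by positivity)
        rw [hw]
        linarith)
    refine le_trans ?_ h
    refine Nat.cast_le.2 (Set.ncard_le_ncard (fun σ hσ => ?_) (Set.toFinite _))
    have h1 : _ ≤ q := hσ.2
    rw [Set.mem_ofPred_eq]
    simp only [phase2, ← hmdef] at h1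
    linarith
  · have : {σ : Fin n ≃ X | J ≤ n - m ∧ (((phase2 n α (List.ofFn σ)).toFinset ∩
        far J (unread α σ) (refClustering A δ k n α (List.ofFn σ))).card : ℝ) ≤ q} = ∅ := by
      rw [Set.eq_empty_iff_forall_notMem]
      exact fun σ hσ => hJn hσ.1
    rw [this]
    simp only [Set.ncard_empty, Nat.cast_zero]
    positivity

/-- The third phase does not contain much more than its share of the `J` furthest unread points. -/
theorem ncard_far_phase3_le (A : Finset X → ℕ → Finset X) {J : ℕ} {Λ : ℝ} (hγ : 0 < γ)
    (hn : 0 < n) (hm : 2 * ⌈α * n⌉₊ ≤ n) (hm' : (⌈α * n⌉₊ : ℝ) ≤ 17 / 100 * n)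
    (hg : (⌈γ * n⌉₊ : ℝ) ≤ 101 / 100 * γ * n) (hΛ : 2 * Λ ≤ γ * J) (hΛ0 : 0 ≤ Λ) :
    ({σ : Fin n ≃ X | 3 * γ * J < (((phase3 n α γ (List.ofFn σ)).toFinset ∩
        far J (unread α σ) (refClustering A δ k n α (List.ofFn σ))).card : ℝ)}.ncard : ℝ) ≤
      Real.exp (-Λ) * Nat.card (Fin n ≃ X) := by
  have hn0 : (0 : ℝ) < n := by exact_mod_cast hn
  set m := ⌈α * n⌉₊ with hmdef
  set g := ⌈γ * n⌉₊ with hgdef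
  have hw : ((window n (2 * m) g).card : ℝ) ≤ 101 / 100 * γ * n := by
    refine le_trans ?_ hg
    exact_mod_cast (by rw [card_window]; omega : (window n (2 * m) g).card ≤ g)
  have hnm : 83 / 100 * (n : ℝ) ≤ ((n - m : ℕ) : ℝ) := by
    rw [Nat.cast_sub (by omega)]
    linarith
  by_cases hJn : J ≤ n - m
  · have h := chernoff_far (X := X) A δ k (n := n) (α := α) (a := 2 * m) (b := g) (J := J) (s := 1)
      (t := 3 * γ * J) (Λ := Λ) (by omega) (by
        have : (0 : ℝ) < ((n - m : ℕ) : ℝ) := lt_of_lt_of_le (by positivity) hnm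
        have : 0 < n - m := by exact_mod_cast this
        omega) hJn (by
        have he := Real.exp_one_lt_d9
        have he' := Real.add_one_le_exp (1 : ℝ)
        have h1 : ((window n (2 * m) g).card : ℝ) * J ≤ 101 / 100 * γ * n * J :=
          mul_le_mul_of_nonneg_right hw (by positivity)
        have h2 : ((window n (2 * m) g).card : ℝ) * J * (Real.exp 1 - 1) ≤
            101 / 100 * γ * n * J * (172 / 100) :=
          mul_le_mul h1 (by linarith) (by linarith) (by positivity)
        have h3 : (3 * γ * J - Λ) * (83 / 100 * (n : ℝ)) ≤ (3 * γ * J - Λ) * ((n - m : ℕ) : ℝ) :=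
          mul_le_mul_of_nonneg_left hnm (by nlinarith)
        have h4 : (2 * Λ) * n ≤ γ * J * n := mul_le_mul_of_nonneg_right hΛ hn0.le
        have h5 : 0 ≤ γ * J * n := by positivity
        linarith)
    refine le_trans ?_ h
    refine Nat.cast_le.2 (Set.ncard_le_ncard (fun σ hσ => ?_) (Set.toFinite _))
    have h1 : 3 * γ * J < _ := hσ
    rw [Set.mem_ofPred_eq, one_mul, one_mul]
    exact h1.le
  · have : {σ : Fin n ≃ X | 3 * γ * J < (((phase3 n α γ (List.ofFn σ)).toFinset ∩
        far J (unread α σ) (refClustering A δ k n α (List.ofFn σ))).card : ℝ)} = ∅ := by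
      rw [Set.eq_empty_iff_forall_notMem]
      intro σ hσ
      have h1 : 3 * γ * J < _ := hσ
      have h2 : (((phase3 n α γ (List.ofFn σ)).toFinset ∩
          far J (unread α σ) (refClustering A δ k n α (List.ofFn σ))).card : ℝ) ≤ g := by
        exact_mod_cast (Finset.card_le_card Finset.inter_subset_left).trans
          ((List.toFinset_card_le _).trans (List.length_take_le _ _))
      have h3 : ((n - m : ℕ) : ℝ) ≤ J := by exact_mod_cast (not_le.1 hJn).le
      have h4 : γ * (83 / 100 * n) ≤ γ * J := mul_le_mul_of_nonneg_left (hnm.trans h3) hγ.le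
      have h5 : 0 < γ * n := by positivity
      linarith
    rw [this]
    simp only [Set.ncard_empty, Nat.cast_zero]
    positivity

/-- When the third phase covers the rest of the stream, it contains half of each large cluster. -/
theorem ncard_half_le (hα : 0 < α) (hα6 : α ≤ 1 / 6)
    (hcard : OPT.card ≤ k) (hn : 0 < n) (hm : 2 * ⌈α * n⌉₊ ≤ n)
    (hm' : (⌈α * n⌉₊ : ℝ) ≤ 17 / 100 * n) :
    ({σ : Fin n ≃ X | γ = 1 - 2 * α ∧ ∃ c ∈ largeCenters k δ α OPT,
        (((phase3 n α γ (List.ofFn σ)).toFinset ∩ cluster OPT c).card : ℝ) <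
          1 / 2 * ((cluster OPT c).card : ℝ)}.ncard : ℝ) ≤
      k * Real.exp (-logTerm k δ) * Nat.card (Fin n ≃ X) := by
  have hn0 : (0 : ℝ) < n := by exact_mod_cast hn
  set L := logTerm k δ with hLdef
  set m := ⌈α * n⌉₊ with hmdef
  set O := largeCenters k δ α OPT with hO
  have hφ := mul_phi (k := k) (δ := δ) hα
  rw [← hLdef] at hφ
  have hOk : (O.card : ℝ) ≤ k := by
    exact_mod_cast (Finset.card_le_card fun c hc => (mem_largeCenters.1 hc).1).trans hcard
  by_cases hγ : γ = 1 - 2 * α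
  · have hw : 65 / 100 * (n : ℝ) ≤ ((window n (2 * m) ⌈γ * n⌉₊).card : ℝ) := by
      have h1 : γ * n ≤ (⌈γ * n⌉₊ : ℝ) := Nat.le_ceil _
      have h2 : 65 / 100 * (n : ℝ) ≤ γ * n := mul_le_mul_of_nonneg_right (by linarith) hn0.le
      rw [card_window, Nat.cast_sub (by omega), le_sub_iff_add_le, Nat.cast_min, le_min_iff]
      push_cast
      constructor <;> linarith
    have h := ncard_exists_le (Ω := Fin n ≃ X) O (fun c => {σ : Fin n ≃ X |
      (((phase3 n α γ (List.ofFn σ)).toFinset ∩ cluster OPT c).card : ℝ) <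
          1 / 2 * ((cluster OPT c).card : ℝ)})
      (ε := Real.exp (-L) * Nat.card (Fin n ≃ X)) (fun c hc => by
        refine lower_tail_card hn (cluster OPT c) (2 * m) ⌈γ * n⌉₊ (Λ := L) ?_
        have h1 : 150 * L ≤ α * ((cluster OPT c).card : ℝ) := by
          rw [← hφ]
          exact mul_le_mul_of_nonneg_left (mem_largeCenters.1 hc).2 hα.le
        have h2 : α * ((cluster OPT c).card : ℝ) ≤ 1 / 6 * ((cluster OPT c).card : ℝ) :=
          mul_le_mul_of_nonneg_right hα6 (by positivity)
        have h3 : 900 * L * n ≤ ((cluster OPT c).card : ℝ) * n :=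
          mul_le_mul_of_nonneg_right (by linarith) hn0.le
        have h4 := mul_le_mul_of_nonneg_right hw
          (by positivity : (0 : ℝ) ≤ ((cluster OPT c).card : ℝ))
        have h5 : (0 : ℝ) ≤ ((cluster OPT c).card : ℝ) * n := by positivity
        linarith)
    refine le_trans ?_ (h.trans ?_)
    · exact Nat.cast_le.2 (Set.ncard_le_ncard (fun σ hσ => hσ.2) (Set.toFinite _))
    · rw [mul_assoc]
      exact mul_le_mul_of_nonneg_right hOk (by positivity)
  · have : {σ : Fin n ≃ X | γ = 1 - 2 * α ∧ ∃ c ∈ O,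
        (((phase3 n α γ (List.ofFn σ)).toFinset ∩ cluster OPT c).card : ℝ) <
          1 / 2 * ((cluster OPT c).card : ℝ)} = ∅ := by
      rw [Set.eq_empty_iff_forall_notMem]
      exact fun σ hσ => hγ hσ.1
    rw [this]
    simp only [Set.ncard_empty, Nat.cast_zero]
    positivity

/-- The first `M` points of the reference cells are good, when `M` is large enough. -/
theorem ncard_first_le (hk : 2 ≤ k) (hδ : 0 < δ) (hδ1 : δ < 1) (hA : IsOfflineAlgorithm A)
    (L : Finset X) :
    ({σ : Fin n ≃ X | Real.log (8 * kPlus k δ / δ) ≤ M ∧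
        ∃ c ∈ refClustering A δ k n α (List.ofFn σ), σ ∈ firstOuter A δ k n α γ M L c}.ncard : ℝ) ≤
      4 * k * Real.exp (-logTerm k δ) * Nat.card (Fin n ≃ X) := by
  have hk0 : (0 : ℝ) < k := by exact_mod_cast (by omega : 0 < k)
  have hL := four_le_logTerm hk hδ hδ1
  have hkp : 0 < kPlus k δ := by
    rw [kPlus_eq]
    positivity
  by_cases hM : Real.log (8 * kPlus k δ / δ) ≤ M
  · have h := ncard_exists_firstOuter_le A δ k n α γ M L
      (fun σ => card_refClustering_le (α := α) hk hδ hδ1 hA (List.ofFn σ))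
    refine le_trans ?_ (h.trans (mul_le_mul_of_nonneg_right ?_ (by positivity)))
    · exact Nat.cast_le.2 (Set.ncard_le_ncard (fun σ hσ => hσ.2) (Set.toFinite _))
    · have h1 : Real.exp (-M) ≤ δ / (8 * kPlus k δ) := by
        rw [← inv_div, ← Real.exp_log (by positivity : 0 < 8 * kPlus k δ / δ), ← Real.exp_neg]
        exact Real.exp_le_exp.2 (by linarith)
      rw [exp_neg_logTerm hk hδ]
      calc kPlus k δ * Real.exp (-M) ≤ kPlus k δ * (δ / (8 * kPlus k δ)) :=
            mul_le_mul_of_nonneg_left h1 hkp.le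
        _ = 4 * k * (δ / (32 * k)) := by
            field_simp
            norm_num
  · have : {σ : Fin n ≃ X | Real.log (8 * kPlus k δ / δ) ≤ M ∧
        ∃ c ∈ refClustering A δ k n α (List.ofFn σ), σ ∈ firstOuter A δ k n α γ M L c} = ∅ := by
      rw [Set.eq_empty_iff_forall_notMem]
      exact fun σ hσ => hM hσ.1
    rw [this]
    simp only [Set.ncard_empty, Nat.cast_zero]
    positivity

/-- The failure probability when the space has at least `φ` points. -/
theorem ncard_not_conclusion_le (hk : 2 ≤ k) (hδ : 0 < δ) (hδ1 : δ < 1) (hα : 0 < α)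
    (hα6 : α ≤ 1 / 6) (hαγ : α < γ) (hγ : γ ≤ 1 - 2 * α) (hτ : 0 < τ) (hβ : 1 ≤ β)
    (hA : IsOfflineAlgorithm A) (hAβ : IsApproximation β A)
    (hOPT : IsOptimal Finset.univ Finset.univ k OPT) (hnφ : phi k δ α ≤ n) :
    ({σ : Fin n ≃ X | ¬ Conclusion A OPT k n δ α γ τ β M 40000 (List.ofFn σ)}.ncard : ℝ) ≤
      δ / 2 * Nat.card (Fin n ≃ X) := by
  obtain ⟨⟨-, hne, hcard⟩, -⟩ := hOPT
  have hk0 : (2 : ℝ) ≤ k := by exact_mod_cast hk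
  have hL := four_le_logTerm hk hδ hδ1
  have hφ := mul_phi (k := k) (δ := δ) hα
  have hγ0 : 0 < γ := hα.trans hαγ
  set L := logTerm k δ with hLdef
  have hαn : 150 * L ≤ α * n := by
    rw [← hφ]
    exact mul_le_mul_of_nonneg_left hnφ hα.le
  have hn0 : (0 : ℝ) < n := by
    refine pos_of_mul_pos_right (a := α) ?_ hα.le
    linarith
  have hn : 0 < n := by exact_mod_cast hn0
  have hαn6 : α * n ≤ 1 / 6 * n := mul_le_mul_of_nonneg_right hα6 hn0.le
  have hmlt : (⌈α * n⌉₊ : ℝ) < α * n + 1 := Nat.ceil_lt_add_one (by positivity)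
  have hm1 : (⌈α * n⌉₊ : ℝ) ≤ 101 / 100 * α * n := by linarith
  have hm2 : (⌈α * n⌉₊ : ℝ) ≤ 17 / 100 * n := by linarith
  have hm : 2 * ⌈α * n⌉₊ ≤ n := by
    have : (2 : ℝ) * ⌈α * n⌉₊ ≤ n := by linarith
    exact_mod_cast this
  have hg : (⌈γ * n⌉₊ : ℝ) ≤ 101 / 100 * γ * n := by
    have h1 : (⌈γ * n⌉₊ : ℝ) < γ * n + 1 := Nat.ceil_lt_add_one (by positivity)
    have h2 : α * n ≤ γ * n := mul_le_mul_of_nonneg_right hαγ.le hn0.le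
    linarith
  -- the number of far points that the second sample can contain
  set q : ℝ := (⌈2 * α * (k + 1) * phi k δ α⌉₊ : ℝ) + 3 * α * k * τ with hq
  have hqL : 5 * L ≤ q := by
    have h1 := Nat.le_ceil (2 * α * (k + 1) * phi k δ α)
    have h2 : 2 * α * (k + 1) * phi k δ α = (k + 1) * (300 * L) := by
      rw [show 300 * L = 2 * (150 * L) by ring, ← hφ]
      ring
    have h3 : 0 ≤ 3 * α * k * τ := by positivity
    nlinarith
  -- a window of length `α n` then contains on average at least `2 q` of the `J` furthest unread points
  set J := ⌈2 * q / α⌉₊ with hJ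
  have hJ1 : 2 * q ≤ α * J := by
    have := Nat.le_ceil (2 * q / α)
    rw [div_le_iff₀ hα] at this
    linarith
  have hJ2 : (J : ℝ) ≤ 2 * q / α + 1 := (Nat.ceil_lt_add_one (div_nonneg (by linarith) hα.le)).le
  have hJγ : 2 * L ≤ γ * J := by
    have : α * (J : ℝ) ≤ γ * J := mul_le_mul_of_nonneg_right hαγ.le (by positivity)
    linarith
  have b1 := ncard_not_goodSamples_le (X := X) hα hL (by omega) hne hcard hn hm hm1
  have b2 := ncard_far_phase2_le (X := X) (δ := δ) (k := k) A hα hn hm hJ1 hqL (by linarith)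
  have b3 := ncard_far_phase3_le (X := X) (δ := δ) (k := k) A hγ0 hn hm hm2 hg hJγ (by linarith)
  have b4 := ncard_half_le (X := X) (δ := δ) (γ := γ) hα hα6 hcard hn hm hm2
  have b5 := ncard_first_le (X := X) (n := n) (α := α) (γ := γ) (M := M) hk hδ hδ1 hA
    (clusterUnion OPT (largeCenters k δ α OPT))
  have b45 := ncard_le_add subset_rfl b4 b5
  have b345 := ncard_le_add subset_rfl b3 b45
  have b2345 := ncard_le_add subset_rfl b2 b345
  refine (ncard_le_add (fun σ hσ => ?_) b1 b2345).trans ?_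
  · by_contra hcon
    simp only [Set.mem_union, Set.mem_ofPred_eq, not_or, not_lt, not_not, not_exists, not_and,
      not_le] at hcon
    obtain ⟨c1, c2, c3, c4, c5⟩ := hcon
    refine hσ ?_
    have hP₁ : (phase1 n α (List.ofFn σ)).toFinset.Nonempty := by
      have h1 : 0 < ⌈α * n⌉₊ := Nat.ceil_pos.2 (by positivity)
      rw [List.toFinset_nonempty_iff]
      refine List.ne_nil_of_length_pos ?_
      rw [phase1, List.length_take, List.length_ofFn]
      omega
    have hT : (refClustering A δ k n α (List.ofFn σ)).Nonempty :=
      (hA _ _ (two_le_floor_kPlus hk hδ hδ1)).2.2 hP₁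
    have hψ : riskEstimate A δ k n α (List.ofFn σ) ≤ (18 * β + 10) * risk Finset.univ OPT :=
      c1.truncRisk_le hk hδ hδ1 hα (by linarith) hAβ hne hcard hP₁
    refine ⟨card_selectProc_le hk hδ hδ1 hα hαγ (by linarith) hτ hA (by omega) hT hJ2 c2 c3,
      fun c _ hc => risk_cluster_selectProc_le hk hα hτ hψ hc, fun hγ' hτ' hM => ?_⟩
    subst hτ'
    exact risk_large_selectProc_le hk hδ hδ1 hα hβ hne hcard hT hψ
      (c1.sum_card_mul_infDist_le hk hδ hδ1 hα (by linarith) hAβ hne hcard hP₁)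
      (c4 hγ') (c5 hM)
  · refine mul_le_mul_of_nonneg_right ?_ (by positivity)
    rw [hLdef, exp_neg_logTerm hk hδ]
    have e : δ / 2 = 16 * k * (δ / (32 * k)) := by
      field_simp
      norm_num
    rw [e]
    have : 0 ≤ δ / (32 * k) := by positivity
    nlinarith

end Probability

end NoSubstClustering

open NoSubstClustering in
theorem theorem2 :
    ∃ C : ℝ, 0 < C ∧
      ∀ (X : Type*) [Fintype X] [MetricSpace X] [LinearOrder X]
        (k : ℕ) (δ α γ τ β : ℝ) (M : ℕ)
        (A : Finset X → ℕ → Finset X) (OPT : Finset X),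
        2 ≤ k → 0 < δ → δ < 1 →
        0 < α → α ≤ 1 / 6 → α < γ → γ ≤ 1 - 2 * α → 0 < τ → 1 ≤ β →
        IsOfflineAlgorithm A → IsApproximation β A →
        IsOptimal Finset.univ Finset.univ k OPT →
        1 - δ / 2 ≤ streamProb {σ : Fin (Fintype.card X) ≃ X |
          let stream : List X := List.ofFn σ
          let P₃ : List X := phase3 (Fintype.card X) α γ stream
          let Tout : Finset X := selectProc A δ k (Fintype.card X) α γ M τ stream
          (Tout.card : ℝ) ≤
              C * (γ / α * k * Real.log (k / δ) + k * τ + (k + Real.log (k / δ)) * M) ∧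
          (∀ c ∈ OPT, c ∈ P₃ →
            Tout.Nonempty ∧
            risk (cluster OPT c) Tout ≤
              risk (cluster OPT c) {c} +
                ((cluster OPT c).card : ℝ) / (k * τ) * (36 * β + 20) * risk Finset.univ OPT) ∧
          (γ = 1 - 2 * α → τ = phi k δ α → Real.log (8 * kPlus k δ / δ) ≤ M →
            ((largePoints k δ α OPT).Nonempty → Tout.Nonempty) ∧
            risk (largePoints k δ α OPT) Tout ≤
              risk (largePoints k δ α OPT) OPT + (468 * β + 260) * risk Finset.univ OPT)} := by
  refine ⟨40000, by norm_num, ?_⟩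
  intro X _ _ _ k δ α γ τ β M A OPT hk hδ hδ1 hα hα6 hαγ hγ hτ hβ hA hAβ hOPT
  change 1 - δ / 2 ≤ streamProb {σ : Fin (Fintype.card X) ≃ X |
    Conclusion A OPT k (Fintype.card X) δ α γ τ β M 40000 (List.ofFn σ)}
  set G : Set (Fin (Fintype.card X) ≃ X) :=
    {σ | Conclusion A OPT k (Fintype.card X) δ α γ τ β M 40000 (List.ofFn σ)} with hG
  have hne : Nonempty (Fin (Fintype.card X) ≃ X) := ⟨(Fintype.equivFin X).symm⟩
  have hN : (0 : ℝ) < Nat.card (Fin (Fintype.card X) ≃ X) := by exact_mod_cast Nat.card_pos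
  have hbad : (Gᶜ.ncard : ℝ) ≤ δ / 2 * Nat.card (Fin (Fintype.card X) ≃ X) := by
    rcases lt_or_ge (Fintype.card X : ℝ) (phi k δ α) with h | h
    · have : Gᶜ = ∅ := by
        rw [Set.compl_empty_iff, Set.eq_univ_iff_forall]
        exact fun σ => conclusion_of_card_lt hk hδ hδ1 hα hαγ (by linarith) hτ hβ rfl h _
      rw [this]
      simp only [Set.ncard_empty, Nat.cast_zero]
      positivity
    · exact ncard_not_conclusion_le hk hδ hδ1 hα hα6 hαγ hγ hτ hβ hA hAβ hOPT h
  have hsum : (G.ncard : ℝ) + Gᶜ.ncard = Nat.card (Fin (Fintype.card X) ≃ X) := by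
    exact_mod_cast Set.ncard_add_ncard_compl G
  rw [streamProb, le_div_iff₀ hN]
  linarith
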